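/- **Setting.** Let $\mathcal S,\mathcal A$ be finite, let $P(\cdot\mid s,a)$ be a transition kernel, $r:\mathcal S\times\mathcal A\to[0,r_{\max}]$ a reward, $\mu_0$ an initial distribution, and $(\pi_\theta)_{\theta\in\mathbb R^q}$ a policy class such that, for every $\theta$, the Markov chain on $\mathcal S$ induced by $\pi_\theta$ is ergodic (irreducible and aperiodic), with $\pi_\theta(a\mid s)>0$, $\theta\mapsto\log\pi_\theta(a\mid s)$ differentiable and $\|\nabla_\theta\log\pi_\theta(a\mid s)\|\le B$ for all $\theta,s,a$. Write $J(\theta)=\lim_{T\to\infty}\mathbb E_{\pi_\theta}\big[\frac1T\sum_{t=0}^T r(s_t,a_t)\big]$ for the average reward, $d^{\pi_\theta}$ for the stationary distribution, and $$\tau_{mix}^\theta=\inf\Big\{t\ge1:\ \sup_s\|P_\theta^t(\cdot\mid s)-d^{\pi_\theta}\|_{TV}\le\tfrac14\Big\}.$$ **Algorithm (multi-level actor-critic).** Fix $T_{\max}\ge2$, features $\phi:\mathcal S\to\mathbb R^m$ with $\|\phi\|\le1$, a nonempty closed convex set $\Omega\subset\mathbb R^m$, critic step sizes $\beta_t\in\mathbb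 R$, and initial values $\theta_1,\eta_1,\omega_1$. At iteration $t=1,2,\dots$ draw $j_t$ with $\Pr(j_t=j)=2^{-j}$, $j\ge1$, independently of the past, and sample $2^{j_t}$ transitions $z_t^i=(s_t^i,a_t^i,s_t^{i+1})$ under $\pi_{\theta_t}$. The first trajectory starts from $\mu_0$; the first state of every later one is drawn from a fixed kernel given the last state of the previous one (this includes continuing a single stream of data, and restarting from $\mu_0$). For $F\in\{f,g,h\}$ with $$\delta=r(s,a)-\eta_t+\langle\phi(s')-\phi(s),\omega_t\rangle,\quad f=\eta_t-r(s,a),\quad g=\delta\,\phi(s),\quad h=\delta\,\nabla_\theta\log\pi_{\theta_t}(a\mid s),$$ put $F_t^{j}=2^{-j}\sum_{i=1}^{2^j}F(z_t^i)$ and $F_t=F_t^0+2^{j_t}(F_t^{j_t}-F_t^{j_t-1})\mathbf 1\{2^{j_t}\le T_{\max}\}$. Update $$\eta_{t+1}=\eta_t-\gamma_tf_t,\qquad \omega_{t+1}=\Pi_\Omega(\omega_t-\beta_tg_t),\qquad \theta_{t+1}=\theta_t+\alpha_th_t,\qquad \alpha_t=\frac{\alpha_t'}{\sqrt{\sum_{k=1}^t\|h_k\|^2}}$$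 (with no actor move while all $h_k$ vanish), where $\gamma_t=(1+t)^{-\nu}$, $\alpha'_t=(1+t)^{-\sigma}$ and $0<\nu<\sigma<1$. Let $\eta_t^*=J(\theta_t)$. **Theorem.** There is a constant $C$ that depends only on $\nu,\sigma,r_{\max},B,|\mathcal S|$ and $\eta_1$ (in particular not on $T$, $T_{\max}$ or mixing times) such that for every such problem and algorithm, every $T\ge1$, and every natural number $\tau_{mix}$ with $\tau_{mix}^{\theta_t}\le\tau_{mix}$ almost surely for $1\le t\le T$ (for example the essential maximum of $\max_{1\le t\le T}\tau_{mix}^{\theta_t}$), the variables $(\eta_t-\eta_t^*)^2$, $1\le t\le T$, are integrable and $$\frac1T\sum_{t=1}^T\mathbb E\big[(\eta_t-\eta_t^*)^2\big]\le C\Big(T^{\nu-1}+T^{-2(\sigma-\nu)}+\tau_{mix}\log(T_{\max})\,T^{-\nu}+\tau_{mix}\frac{\log T_{\max}}{T_{\max}}\Big).$$ -/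

import Mathlib

open Filter Topology
open scoped InnerProductSpace

noncomputable section

namespace MAC

/-! ### Finite Markov decision processes under the average-reward criterion -/

/-- A Markov decision process: transition kernel, reward and initial state distribution. -/
structure MDP (S A : Type*) where
  P : S → A → PMF S
  r : S → A → ℝ
  μ₀ : PMF S

/-- A stationary randomized policy. -/
abbrev Policy (S A : Type*) := S → PMF A

namespace MDP

variable {S A : Type*} (M : MDP S A) (p : Policy S A)

/-- One step of the Markov chain that the policy induces on the states. -/
def chain (s : S) : PMF S := (p s).bind fun a => M.P s a

/-- The law of the state after `t` steps from `s`, i.e. `P^t(· | s)`. -/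
def nStep : ℕ → S → PMF S
  | 0, s => PMF.pure s
  | t + 1, s => (nStep t s).bind (M.chain p)

/-- The law of the state at time `t` when the initial state has law `μ₀`. -/
def stateLaw (t : ℕ) : PMF S := M.μ₀.bind (M.nStep p t)

/-- Ergodicity of a finite chain (irreducible and aperiodic): for some `k`, every state is reached
from every state in exactly `k` steps with positive probability. -/
def Ergodic : Prop := ∃ k : ℕ, ∀ s s' : S, M.nStep p k s s' ≠ 0

variable [Fintype S] [Fintype A]

/-- The expected reward collected in state `s`. -/
def meanReward (s : S) : ℝ := ∑ a, (p s a).toReal * M.r s a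

/-- The long-term average reward
`J(π) = lim_{T → ∞} E[(1/T) ∑_{t=0}^{T} r(s_t, a_t)]`. -/
def avgReward : ℝ :=
  limUnder atTop fun T : ℕ =>
    (1 / (T : ℝ)) * ∑ t ∈ Finset.range (T + 1), ∑ s, (M.stateLaw p t s).toReal * M.meanReward p s

/-- The stationary distribution
`d(s) = lim_{T → ∞} (1/T) ∑_{t=0}^{T-1} Pr(s_t = s)`. -/
def stationary (s : S) : ℝ :=
  limUnder atTop fun T : ℕ =>
    (1 / (T : ℝ)) * ∑ t ∈ Finset.range T, (M.stateLaw p t s).toReal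

/-- `m(t) = sup_s ‖P^t(· | s) - d‖_TV`. -/
def mixDist (t : ℕ) : ℝ :=
  ⨆ s : S, (1 / 2 : ℝ) * ∑ s' : S, |(M.nStep p t s s').toReal - M.stationary p s'|

/-- The mixing time `inf {t ≥ 1 : m(t) ≤ 1/4}`. -/
def mixingTime : ℕ := sInf {t : ℕ | 1 ≤ t ∧ M.mixDist p t ≤ 1 / 4}

end MDP

/-! ### The multi-level actor-critic -/

/-- Actor parameters or critic weights. -/
abbrev Vec (k : ℕ) := EuclideanSpace ℝ (Fin k)

/-- One observed transition `(s, a, s')`. -/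
abbrev Sample (S A : Type*) := S × A × S

/-- The Euclidean projection onto a nonempty closed convex set. -/
def proj {k : ℕ} (Ω : Set (Vec k)) (hne : Ω.Nonempty) (hcl : IsClosed Ω) (hcv : Convex ℝ Ω)
    (u : Vec k) : Vec k :=
  (exists_norm_eq_iInf_of_complete_convex hne hcl.isComplete hcv u).choose

/-- The input of the multi-level actor-critic algorithm. -/
structure Config (S A : Type*) (q m : ℕ) where
  mdp : MDP S A
  /-- the parametrized policy class `θ ↦ π_θ` -/
  policy : Vec q → Policy S A
  /-- the feature map of the linear critic -/
  φ : S → Vec m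
  φ_le : ∀ s, ‖φ s‖ ≤ 1
  /-- the set onto which the critic weights are projected -/
  Ω : Set (Vec m)
  Ω_nonempty : Ω.Nonempty
  Ω_closed : IsClosed Ω
  Ω_convex : Convex ℝ Ω
  /-- How the first state of a trajectory is drawn, given the last state of the previous one:
  `PMF.pure` continues the same stream of data, `fun _ => mdp.μ₀` restarts it. -/
  restart : S → PMF S
  /-- step sizes of the critic -/
  β : ℕ → ℝ
  /-- step sizes of the average reward tracker -/
  γ : ℕ → ℝ
  /-- auxiliary step sizes of the actor -/
  α' : ℕ → ℝ
  /-- the maximal trajectory length -/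
  Tmax : ℕ
  θ₁ : Vec q
  η₁ : ℝ
  ω₁ : Vec m

/-- The state of the algorithm at the start of an iteration: actor parameter, reward tracker,
critic weight, the sum of the squared norms of the past actor gradient estimates, and the first
state of the trajectory to be sampled. -/
structure AlgState (S : Type*) (q m : ℕ) where
  θ : Vec q
  η : ℝ
  ω : Vec m
  sumSq : ℝ
  s : S

/-- The average `2^{-j} ∑_{i=1}^{2^j} F(z_i)` over the first `2^j` samples of a trajectory. -/
def levelAvg {Z V : Type*} [AddCommGroup V] [Module ℝ V] (F : Z → V) (z : List Z) (j : ℕ) : V :=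
  ((2 : ℝ) ^ j)⁻¹ • ((z.take (2 ^ j)).map F).sum

/-- The multi-level Monte Carlo estimator built on the level `j ≥ 1`. -/
def mlmc {Z V : Type*} [AddCommGroup V] [Module ℝ V] (Tmax : ℕ) (F : Z → V) (z : List Z)
    (j : ℕ) : V :=
  levelAvg F z 0 +
    if 2 ^ j ≤ Tmax then (2 : ℝ) ^ j • (levelAvg F z j - levelAvg F z (j - 1)) else 0

/-- The geometric law of the level: `Pr(j) = 2^{-j}` for `j = 1, 2, …`. -/
def levelLaw : PMF ℕ :=
  PMF.map (· + 1) (⟨fun n : ℕ => (2⁻¹ : ENNReal) ^ (n + 1), by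
    have h : ∑' n : ℕ, (2⁻¹ : ENNReal) ^ (n + 1) = 1 := by
      rw [ENNReal.tsum_geometric_add_one, ENNReal.one_sub_inv_two, inv_inv]
      exact ENNReal.inv_mul_cancel (by norm_num) (by norm_num)
    exact h ▸ ENNReal.summable.hasSum⟩ : PMF ℕ)

namespace Config

variable {S A : Type*} {q m : ℕ} (c : Config S A q m)

/-- The score `∇_θ log π_θ(a | s)`. -/
def score (θ : Vec q) (s : S) (a : A) : Vec q :=
  gradient (fun θ' => Real.log (c.policy θ' s a).toReal) θ

/-- The temporal difference `r(s,a) - η + ⟨φ(s') - φ(s), ω⟩`. -/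
def tdError (x : AlgState S q m) (z : Sample S A) : ℝ :=
  c.mdp.r z.1 z.2.1 - x.η + ⟪c.φ z.2.2 - c.φ z.1, x.ω⟫_ℝ

/-- The reward tracking direction `η - r(s,a)`. -/
def fSample (x : AlgState S q m) (z : Sample S A) : ℝ := x.η - c.mdp.r z.1 z.2.1

/-- The critic direction. -/
def gSample (x : AlgState S q m) (z : Sample S A) : Vec m := c.tdError x z • c.φ z.1

/-- The actor direction. -/
def hSample (x : AlgState S q m) (z : Sample S A) : Vec q :=
  c.tdError x z • c.score x.θ z.1 z.2.1

/-- The law of a trajectory of `N` transitions from `s` under `π_θ`. -/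
def trajectory (θ : Vec q) : ℕ → S → PMF (List (Sample S A))
  | 0, _ => PMF.pure []
  | N + 1, s =>
    (c.policy θ s).bind fun a =>
      (c.mdp.P s a).bind fun s' =>
        (trajectory θ N s').map fun l => (s, a, s') :: l

/-- The updates of iteration `t` from the trajectory `z` sampled at level `j`; `s'` is the first
state of the next trajectory. The actor makes an AdaGrad step of size
`α'_t / √(∑_{k=1}^t ‖h_k‖²)`. -/
def update (t : ℕ) (x : AlgState S q m) (j : ℕ) (z : List (Sample S A)) (s' : S) :
    AlgState S q m :=
  let f := mlmc c.Tmax (c.fSample x) z j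
  let g := mlmc c.Tmax (c.gSample x) z j
  let h := mlmc c.Tmax (c.hSample x) z j
  let G := x.sumSq + ‖h‖ ^ 2
  { θ := x.θ + (c.α' t / √G) • h
    η := x.η - c.γ t * f
    ω := proj c.Ω c.Ω_nonempty c.Ω_closed c.Ω_convex (x.ω - c.β t • g)
    sumSq := G
    s := s' }

/-- The state reached at the end of the trajectory `z` started at `s`. -/
def lastState (s : S) (z : List (Sample S A)) : S := (z.getLast?.map fun y => y.2.2).getD s

/-- Iteration `t` of the algorithm: draw a level `j`, sample `2^j` transitions under the current
policy, update. -/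
def step (t : ℕ) (x : AlgState S q m) : PMF (AlgState S q m) :=
  levelLaw.bind fun j =>
    (c.trajectory x.θ (2 ^ j) x.s).bind fun z =>
      (c.restart (lastState x.s z)).map fun s' => c.update t x j z s'

/-- The law of the algorithm's state at the start of iteration `1`. -/
def init : PMF (AlgState S q m) :=
  c.mdp.μ₀.map fun s => { θ := c.θ₁, η := c.η₁, ω := c.ω₁, sumSq := 0, s := s }

/-- The law of the algorithm's state at the start of iteration `t`, for `t = 1, 2, …` (the value
at `t = 0` is not used). -/
def law : ℕ → PMF (AlgState S q m)
  | 0 => c.init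
  | 1 => c.init
  | t + 2 => (law (t + 1)).bind (c.step (t + 1))

variable [Fintype S] [Fintype A]

/-- The optimal tracker value `η_t^* = J(π_{θ_t})` at the parameter `θ`. -/
def J (θ : Vec q) : ℝ := c.mdp.avgReward (c.policy θ)

/-- The squared tracking error `(η - η^*)²`. -/
def sqError (x : AlgState S q m) : ℝ := (x.η - c.J x.θ) ^ 2

/-- The mixing time of the chain that `π_θ` induces. -/
def tauMix (θ : Vec q) : ℕ := c.mdp.mixingTime (c.policy θ)

/-- The score function of the policy class exists and is bounded by `B`. -/
def BoundedScore (B : ℝ) : Prop :=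
  ∀ s a, (∀ θ, c.policy θ s a ≠ 0) ∧
    Differentiable ℝ (fun θ => Real.log (c.policy θ s a).toReal) ∧
    ∀ θ, ‖c.score θ s a‖ ≤ B

end Config

/-- The expectation of a real function of a discrete random variable. -/
def expect {X : Type*} (p : PMF X) (F : X → ℝ) : ℝ := ∑' x, (p x).toReal * F x

end MAC

end

/-! Write e = η_t - J(θ_t). Since the multi-level estimator preserves constants, one iteration gives
e' = (1 - γ)e + γX - Δ, where X estimates the mean of r - J(θ_t) and Δ is the change of J caused by
the actor step. Squaring and conditioning on the past leaves three quantities to control: Δ, the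
conditional mean of X and its second moment.

Drift. The AdaGrad normalization makes the actor step at most α', and J is Lipschitz with the
constant (2|S| + 1) B rmax, free of mixing times (`Config.abs_J_sub_le`). The reason is
multiplicative: the score bound lets action probabilities change by a factor of at most ρ = exp(B‖θ'
- θ‖), hence also the transition matrix. Changing one row by such a factor changes the stationary
measure, normalized at that state, by at most ρ. Row by row, the stationary distribution changes by
at most ρ^(2|S|) (`IsErgodic.stationary_le`).

Estimator. Below the mixing time nothing is needed; beyond it the oscillation of P^t f halves every
τ steps, so every accumulated centred reward has mean O(τ), uniformly in length and initial state.
Its second moment therefore grows linearly with slope O(τ). The level weights 2^(-j) make the mean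
of X telescope to that of one average over about Tmax samples, while each of the log₂ Tmax levels
adds O(τ) to the second moment (`Config.levelEst_moments`).

Recursion. With Young's inequality, E e² satisfies A' ≤ (1 - γ/2)A + c₁α'²/γ + c₂γ² + c₃γ
(`Config.expect_step_sqError_le`). Dividing by γ and summing by parts yields the four rates
(`exists_average_le`). -/

namespace MAC

open Matrix

/-! ### Ergodic stochastic matrices -/

section Stochastic

variable {S : Type*} [Fintype S]

/-- The oscillation of `f` is at most `K`. -/
def OscLE (f : S → ℝ) (K : ℝ) : Prop := ∀ s s', f s - f s' ≤ K

/-- `d` is a stationary probability vector of the matrix `Q`. -/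
structure IsStationary (Q : Matrix S S ℝ) (d : S → ℝ) : Prop where
  nonneg : ∀ s, 0 ≤ d s
  sum_one : ∑ s, d s = 1
  invariant : ∀ y, ∑ s, d s * Q s y = d y

/-- A weighted average of `f` differs from every value of `f` by at most the oscillation. -/
lemma abs_sum_mul_sub_le {w f : S → ℝ} {K : ℝ} (hw : ∀ s, 0 ≤ w s) (hw1 : ∑ s, w s = 1)
    (hf : OscLE f K) (s : S) : |∑ y, w y * f y - f s| ≤ K := by
  have h : ∑ y, w y * f y - f s = ∑ y, w y * (f y - f s) := by
    simp only [mul_sub, Finset.sum_sub_distrib, ← Finset.sum_mul, hw1, one_mul]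
  have hK : K = ∑ y, w y * K := by rw [← Finset.sum_mul, hw1, one_mul]
  rw [h, abs_le]
  constructor
  · rw [hK, ← Finset.sum_neg_distrib]
    refine Finset.sum_le_sum fun y _ => ?_
    nlinarith [hw y, hf s y]
  · rw [hK]
    exact Finset.sum_le_sum fun y _ => mul_le_mul_of_nonneg_left (hf y s) (hw y)

/-- Two weighted averages of `f` differ by at most the total variation distance of the weights
times the oscillation of `f`. -/
lemma sum_mul_sub_sum_mul_le {w w' f : S → ℝ} {K κ : ℝ} (hw1 : ∑ s, w s = 1)
    (hw1' : ∑ s, w' s = 1) (hκ : ∑ s, |w s - w' s| ≤ 2 * κ) (hf : OscLE f K) :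
    ∑ y, w y * f y - ∑ y, w' y * f y ≤ κ * K := by
  have hne : Nonempty S := by
    by_contra h
    rw [not_nonempty_iff] at h
    simp at hw1
  obtain ⟨y₀, hy₀⟩ := Finite.exists_min f
  have hK : 0 ≤ K := by simpa using hf y₀ y₀
  -- Centring at the midpoint of the range costs K/2 per unit of mass and gives κK instead of 2κK.
  set b := f y₀ + K / 2 with hb
  have hfb : ∀ y, |f y - b| ≤ K / 2 := fun y => by
    rw [abs_le]; constructor <;> linarith [hy₀ y, hf y y₀]
  have h : ∑ y, w y * f y - ∑ y, w' y * f y = ∑ y, (w y - w' y) * (f y - b) := by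
    simp only [sub_mul, mul_sub, Finset.sum_sub_distrib, ← Finset.sum_mul, hw1, hw1']
    ring
  rw [h]
  calc ∑ y, (w y - w' y) * (f y - b) ≤ ∑ y, |w y - w' y| * (K / 2) := by
        refine Finset.sum_le_sum fun y _ => (le_abs_self _).trans ?_
        rw [abs_mul]
        exact mul_le_mul_of_nonneg_left (hfb y) (abs_nonneg _)
    _ = (∑ y, |w y - w' y|) * (K / 2) := by rw [Finset.sum_mul]
    _ ≤ (2 * κ) * (K / 2) := mul_le_mul_of_nonneg_right hκ (by linarith)
    _ = κ * K := by ring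

variable [DecidableEq S]

/-- A stochastic matrix with a power all of whose entries are positive. -/
structure IsErgodic (Q : Matrix S S ℝ) : Prop where
  stoch : Q ∈ rowStochastic ℝ S
  primitive : ∃ k, ∀ s y, 0 < (Q ^ k) s y

/-- Dobrushin contraction: the values of `Q *ᵥ f` are averages of `f` against the rows of `Q`, which
are κ-close in total variation. -/
lemma OscLE.mulVec {Q : Matrix S S ℝ} (hQ : Q ∈ rowStochastic ℝ S) {κ : ℝ}
    (hκ : ∀ s s', ∑ y, |Q s y - Q s' y| ≤ 2 * κ) {f : S → ℝ} {K : ℝ} (hf : OscLE f K) :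
    OscLE (Q *ᵥ f) (κ * K) := fun s s' =>
  sum_mul_sub_sum_mul_le (sum_row_of_mem_rowStochastic hQ s) (sum_row_of_mem_rowStochastic hQ s')
    (hκ s s') hf

lemma OscLE.mulVec_pow {Q : Matrix S S ℝ} (hQ : Q ∈ rowStochastic ℝ S) {κ : ℝ}
    (hκ : ∀ s s', ∑ y, |Q s y - Q s' y| ≤ 2 * κ) {f : S → ℝ} {K : ℝ} (hf : OscLE f K) (j : ℕ) :
    OscLE (Q ^ j *ᵥ f) (κ ^ j * K) := by
  induction j with
  | zero => simpa using hf
  | succ j ih =>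
    rw [pow_succ', ← mulVec_mulVec, pow_succ', mul_assoc]
    exact ih.mulVec hQ hκ

lemma sum_abs_sub_le_two {Q : Matrix S S ℝ} (hQ : Q ∈ rowStochastic ℝ S) (s s' : S) :
    ∑ y, |Q s y - Q s' y| ≤ 2 * 1 := by
  calc ∑ y, |Q s y - Q s' y| ≤ ∑ y, (Q s y + Q s' y) := by
        refine Finset.sum_le_sum fun y _ => ?_
        have h1 := nonneg_of_mem_rowStochastic hQ (i := s) (j := y)
        have h2 := nonneg_of_mem_rowStochastic hQ (i := s') (j := y)
        rw [abs_le]; constructor <;> linarith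
    _ = 2 * 1 := by
        rw [Finset.sum_add_distrib, sum_row_of_mem_rowStochastic hQ,
          sum_row_of_mem_rowStochastic hQ]; norm_num

/-- If the rows of `Q ^ k` are within total variation distance `κ` of each other, the oscillation
of `Q ^ t f` decays geometrically. -/
lemma OscLE.mulVec_pow_div {Q : Matrix S S ℝ} (hQ : Q ∈ rowStochastic ℝ S) {κ : ℝ} {k : ℕ}
    (hκ : ∀ s s', ∑ y, |(Q ^ k) s y - (Q ^ k) s' y| ≤ 2 * κ) {f : S → ℝ} {K : ℝ}
    (hf : OscLE f K) (t : ℕ) : OscLE (Q ^ t *ᵥ f) (κ ^ (t / k) * K) := by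
  -- Full blocks of length `k` contract by κ each; the remaining steps do not enlarge the
  -- oscillation.
  have h : Q ^ t = (Q ^ k) ^ (t / k) * Q ^ (t % k) := by
    rw [← pow_mul, ← pow_add, Nat.div_add_mod]
  rw [h, ← mulVec_mulVec]
  refine OscLE.mulVec_pow (pow_mem hQ k) hκ ?_ _
  simpa using hf.mulVec_pow hQ (sum_abs_sub_le_two hQ) (t % k)

namespace IsErgodic

variable {Q : Matrix S S ℝ}

/-- The exponent in `primitive` may be 0 when there is at most one state; division by the block
length needs a nonzero one. -/
lemma exists_pos_pow (hQ : IsErgodic Q) : ∃ k, k ≠ 0 ∧ ∀ s y, 0 < (Q ^ k) s y := by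
  obtain ⟨k, hk⟩ := hQ.primitive
  refine ⟨k + 1, k.succ_ne_zero, fun s y => ?_⟩
  rw [pow_succ', mul_apply]
  have h0 : ∀ z, 0 ≤ Q s z := fun z => nonneg_of_mem_rowStochastic hQ.stoch
  obtain ⟨z, -, hz⟩ : ∃ z ∈ Finset.univ, Q s z ≠ 0 := Finset.exists_ne_zero_of_sum_ne_zero (by
    rw [sum_row_of_mem_rowStochastic hQ.stoch]; exact one_ne_zero)
  exact Finset.sum_pos' (fun z _ => mul_nonneg (h0 z) (hk z y).le)
    ⟨z, Finset.mem_univ z, mul_pos ((h0 z).lt_of_ne' hz) (hk z y)⟩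

/-- Doeblin minorization: all rows of a positive power share the mass |S|δ, where δ is its smallest
entry, so they differ by at most 1 - |S|δ in total variation. -/
lemma exists_contraction (hQ : IsErgodic Q) : ∃ k ≠ 0, ∃ κ : ℝ, 0 ≤ κ ∧ κ < 1 ∧
    ∀ s s', ∑ y, |(Q ^ k) s y - (Q ^ k) s' y| ≤ 2 * κ := by
  obtain ⟨k, hk0, hk⟩ := hQ.exists_pos_pow
  have hst := pow_mem hQ.stoch k
  rcases isEmpty_or_nonempty S with hS | hS
  · exact ⟨k, hk0, 0, le_rfl, one_pos, fun s => isEmptyElim s⟩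
  obtain ⟨⟨a, b⟩, hab⟩ := Finite.exists_min fun x : S × S => (Q ^ k) x.1 x.2
  set δ := (Q ^ k) a b
  have hδ : 0 < δ := hk a b
  have hδ' : ∀ s y, δ ≤ (Q ^ k) s y := fun s y => hab (s, y)
  have hn : (0 : ℝ) < Fintype.card S := by exact_mod_cast Fintype.card_pos
  refine ⟨k, hk0, 1 - Fintype.card S * δ, ?_, by nlinarith, fun s s' => ?_⟩
  · have : ∑ _y : S, δ ≤ ∑ y, (Q ^ k) a y := Finset.sum_le_sum fun y _ => hδ' a y
    rw [sum_row_of_mem_rowStochastic hst] at this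
    simp at this
    linarith
  · calc ∑ y, |(Q ^ k) s y - (Q ^ k) s' y| ≤ ∑ y, ((Q ^ k) s y + (Q ^ k) s' y - 2 * δ) := by
          refine Finset.sum_le_sum fun y _ => ?_
          rw [abs_le]; constructor <;> linarith [hδ' s y, hδ' s' y]
      _ = 2 * (1 - Fintype.card S * δ) := by
          rw [Finset.sum_sub_distrib, Finset.sum_add_distrib, sum_row_of_mem_rowStochastic hst,
            sum_row_of_mem_rowStochastic hst]
          simp; ring

/-- The oscillation of `Q ^ t f` tends to zero. -/
lemma exists_osc_tendsto (hQ : IsErgodic Q) {f : S → ℝ} {K : ℝ} (hf : OscLE f K) :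
    ∃ b : ℕ → ℝ, Tendsto b atTop (𝓝 0) ∧ ∀ t, OscLE (Q ^ t *ᵥ f) (b t) := by
  obtain ⟨k, hk0, κ, hκ0, hκ1, hκ⟩ := hQ.exists_contraction
  refine ⟨fun t => κ ^ (t / k) * K, ?_, fun t => hf.mulVec_pow_div hQ.stoch hκ t⟩
  simpa using ((tendsto_pow_atTop_nhds_zero_of_lt_one hκ0 hκ1).comp
    (Nat.tendsto_div_const_atTop hk0)).mul_const K

end IsErgodic

/-! ### Stationary vectors: convergence, uniqueness, existence, positivity. -/

omit [DecidableEq S] in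
lemma IsStationary.sum_mul_mulVec {Q : Matrix S S ℝ} {d : S → ℝ} (hd : IsStationary Q d)
    (f : S → ℝ) : ∑ s, d s * (Q *ᵥ f) s = ∑ s, d s * f s := by
  have h : d ᵥ* Q = d := funext hd.invariant
  change d ⬝ᵥ (Q *ᵥ f) = d ⬝ᵥ f
  rw [dotProduct_mulVec, h]

lemma IsStationary.sum_mul_pow_mulVec {Q : Matrix S S ℝ} {d : S → ℝ} (hd : IsStationary Q d)
    (f : S → ℝ) (t : ℕ) : ∑ s, d s * (Q ^ t *ᵥ f) s = ∑ s, d s * f s := by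
  induction t with
  | zero => simp
  | succ t ih => rw [pow_succ', ← mulVec_mulVec, hd.sum_mul_mulVec, ih]

lemma IsStationary.abs_sub_le {Q : Matrix S S ℝ} {d : S → ℝ} (hd : IsStationary Q d)
    {f : S → ℝ} {K : ℝ} {t : ℕ} (h : OscLE (Q ^ t *ᵥ f) K) (s : S) :
    |(Q ^ t *ᵥ f) s - ∑ y, d y * f y| ≤ K := by
  rw [← hd.sum_mul_pow_mulVec f t, abs_sub_comm]
  exact abs_sum_mul_sub_le hd.nonneg hd.sum_one h s

omit [Fintype S] in
lemma oscLE_single (y : S) : OscLE (Pi.single y (1 : ℝ)) 1 := fun s s' => by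
  by_cases h : s = y <;> by_cases h' : s' = y <;> simp [h, h']

lemma IsErgodic.tendsto {Q : Matrix S S ℝ} (hQ : IsErgodic Q) {d : S → ℝ}
    (hd : IsStationary Q d) (s y : S) : Tendsto (fun t => (Q ^ t) s y) atTop (𝓝 (d y)) := by
  obtain ⟨b, hb, hosc⟩ := hQ.exists_osc_tendsto (oscLE_single y)
  rw [tendsto_iff_dist_tendsto_zero]
  refine squeeze_zero (fun _ => dist_nonneg) (fun t => ?_) hb
  have := hd.abs_sub_le (hosc t) s
  simpa [Real.dist_eq, Pi.single_apply] using this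

lemma IsErgodic.stationary_unique {Q : Matrix S S ℝ} (hQ : IsErgodic Q) {d d' : S → ℝ}
    (hd : IsStationary Q d) (hd' : IsStationary Q d') : d = d' := by
  funext y
  exact tendsto_nhds_unique (hQ.tendsto hd y y) (hQ.tendsto hd' y y)

lemma IsErgodic.exists_stationary [Nonempty S] {Q : Matrix S S ℝ} (hQ : IsErgodic Q) :
    ∃ d, IsStationary Q d := by
  obtain ⟨s₀⟩ := ‹Nonempty S›
  have hlim : ∀ y, ∃ l, Tendsto (fun t => (Q ^ t) s₀ y) atTop (𝓝 l) := fun y => by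
    obtain ⟨b, hb, hosc⟩ := hQ.exists_osc_tendsto (oscLE_single y)
    -- The entry of Q^(u+n) at `s₀` is an average over initial states of entries of Q^n, hence
    -- within the oscillation `b n` of its entry at `s₀`.
    refine cauchySeq_tendsto_of_complete (cauchySeq_of_le_tendsto_0' b (fun n m hnm => ?_) hb)
    obtain ⟨u, rfl⟩ := Nat.exists_eq_add_of_le' hnm
    have hw := pow_mem hQ.stoch u
    have := abs_sum_mul_sub_le (fun s => nonneg_of_mem_rowStochastic hw (i := s₀) (j := s))
      (sum_row_of_mem_rowStochastic hw s₀) (hosc n) s₀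
    rw [dist_comm, Real.dist_eq]
    refine le_trans (le_of_eq ?_) this
    congr 2
    · rw [pow_add, mul_apply]
      simp
    · simp
  choose d hd using hlim
  have hst := fun t => pow_mem hQ.stoch t
  refine ⟨d, fun y => ge_of_tendsto' (hd y) fun t => nonneg_of_mem_rowStochastic (hst t), ?_, ?_⟩
  · refine tendsto_nhds_unique (tendsto_finsetSum _ fun y _ => hd y) ?_
    simp only [sum_row_of_mem_rowStochastic (hst _)]
    exact tendsto_const_nhds
  · intro y
    refine tendsto_nhds_unique (tendsto_finsetSum _ fun s _ => (hd s).mul_const (Q s y)) ?_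
    have := (hd y).comp (tendsto_add_atTop_nat 1)
    refine this.congr fun t => ?_
    simp [pow_succ, mul_apply]

lemma IsErgodic.stationary_pos {Q : Matrix S S ℝ} (hQ : IsErgodic Q) {d : S → ℝ}
    (hd : IsStationary Q d) (y : S) : 0 < d y := by
  obtain ⟨k, hk⟩ := hQ.primitive
  have h := hd.sum_mul_pow_mulVec (Pi.single y 1) k
  simp [Pi.single_apply] at h
  rw [← h]
  obtain ⟨s, -, hs⟩ : ∃ s ∈ Finset.univ, d s ≠ 0 := Finset.exists_ne_zero_of_sum_ne_zero (by
    rw [hd.sum_one]; exact one_ne_zero)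
  exact Finset.sum_pos' (fun s _ => mul_nonneg (hd.nonneg s) (hk s y).le)
    ⟨s, Finset.mem_univ s, mul_pos ((hd.nonneg s).lt_of_ne' hs) (hk s y)⟩

/-! ### Multiplicative perturbation of the stationary distribution -/

/-- A nonnegative vector that is subinvariant off `x` and vanishes at `x` is zero. -/
lemma IsErgodic.eq_zero_of_subinvariant {Q : Matrix S S ℝ} (hQ : IsErgodic Q) {v : S → ℝ}
    (hv : ∀ y, 0 ≤ v y) {x : S} (hx : v x = 0)
    (hsub : ∀ y ≠ x, v y ≤ ∑ z, v z * Q z y) (y : S) : v y = 0 := by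
  have h0 : ∀ z y, 0 ≤ Q z y := fun z y => nonneg_of_mem_rowStochastic hQ.stoch
  have hle : ∀ y ∈ Finset.univ, v y ≤ ∑ z, v z * Q z y := fun y _ => by
    by_cases h : y = x
    · rw [h, hx]
      exact Finset.sum_nonneg fun z _ => mul_nonneg (hv z) (h0 z x)
    · exact hsub y h
  -- A stochastic matrix preserves total mass, so subinvariance at every state forces invariance,
  -- and positivity of a power then spreads the zero at `x` everywhere.
  have hsum : ∑ y, v y = ∑ y, ∑ z, v z * Q z y := by
    rw [Finset.sum_comm]
    simp only [← Finset.mul_sum, sum_row_of_mem_rowStochastic hQ.stoch, mul_one]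
  have heq : ∀ y, v y = ∑ z, v z * Q z y := fun y =>
    (Finset.sum_eq_sum_iff_of_le hle).1 hsum y (Finset.mem_univ y)
  have hinv : v ᵥ* Q = v := funext fun y => (heq y).symm
  have hpow : ∀ k : ℕ, v ᵥ* Q ^ k = v := fun k => by
    induction k with
    | zero => simp
    | succ k ih => rw [pow_succ, ← vecMul_vecMul, ih, hinv]
  obtain ⟨k, hk⟩ := hQ.primitive
  have h1 : ∑ z, v z * (Q ^ k) z x = 0 := (congrFun (hpow k) x).trans hx
  have h2 := (Finset.sum_eq_zero_iff_of_nonneg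
    fun z _ => mul_nonneg (hv z) (hk z x).le).1 h1 y (Finset.mem_univ y)
  exact (mul_eq_zero.1 h2).resolve_right (hk y x).ne'

/-- Changing the row `x` by a factor of at most `ρ` changes the stationary measure normalized at
`x` by a factor of at most `ρ`. -/
lemma IsErgodic.stationary_ratio_le {Q Q' : Matrix S S ℝ} (hQ : IsErgodic Q)
    {d d' : S → ℝ} (hd : IsStationary Q d) (hd' : IsStationary Q' d') {x : S} (hpos : 0 < d x)
    (hpos' : 0 < d' x) {ρ : ℝ} (hρ1 : 1 ≤ ρ) (hrow : ∀ z ≠ x, Q' z = Q z)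
    (hρ : ∀ y, Q' x y ≤ ρ * Q x y) (y : S) : d' y / d' x ≤ ρ * (d y / d x) := by
  -- The positive part of the violation. It vanishes at `x`, where both measures are normalized to
  -- 1, and it is subinvariant: off `x` the rows agree, and the contribution of row `x` is `Q' x y -
  -- ρ * Q x y ≤ 0`.
  set v : S → ℝ := fun y => max 0 (d' y / d' x - ρ * (d y / d x)) with hvdef
  have h0 : ∀ z y, 0 ≤ Q z y := fun z y => nonneg_of_mem_rowStochastic hQ.stoch
  have hvx : v x = 0 := by
    simp only [hvdef, div_self hpos.ne', div_self hpos'.ne']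
    exact max_eq_left (by linarith)
  have key : ∀ y, d' y / d' x - ρ * (d y / d x) ≤ ∑ z, v z * Q z y := fun y => by
    rw [← hd.invariant y, ← hd'.invariant y, Finset.sum_div, Finset.sum_div, Finset.mul_sum,
      ← Finset.sum_sub_distrib]
    refine Finset.sum_le_sum fun z _ => ?_
    by_cases hz : z = x
    · subst hz
      rw [hvx, zero_mul, mul_div_right_comm, mul_div_right_comm, div_self hpos.ne',
        div_self hpos'.ne', one_mul, one_mul]
      linarith [hρ y]
    · rw [hrow z hz]
      have : d' z * Q z y / d' x - ρ * (d z * Q z y / d x)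
          = (d' z / d' x - ρ * (d z / d x)) * Q z y := by ring
      rw [this]
      exact mul_le_mul_of_nonneg_right (le_max_right _ _) (h0 z y)
  have hv := hQ.eq_zero_of_subinvariant (v := v) (fun y => le_max_left _ _) hvx (fun y _ =>
    max_le (Finset.sum_nonneg fun z _ => mul_nonneg (le_max_left _ _) (h0 z y)) (key y)) y
  have := le_max_right 0 (d' y / d' x - ρ * (d y / d x))
  change _ ≤ v y at this
  linarith

/-- An entrywise lower bound passes to powers. This makes the intermediate matrices of the
row-by-row interpolation ergodic. -/
lemma IsErgodic.of_le {Q Q' : Matrix S S ℝ} (hQ : IsErgodic Q) (hst : Q' ∈ rowStochastic ℝ S)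
    {δ : ℝ} (hδ : 0 < δ) (h : ∀ z y, δ * Q z y ≤ Q' z y) : IsErgodic Q' := by
  refine ⟨hst, ?_⟩
  have hpow : ∀ k : ℕ, ∀ z y, δ ^ k * (Q ^ k) z y ≤ (Q' ^ k) z y := fun k => by
    induction k with
    | zero => simp
    | succ k ih =>
      intro z y
      rw [pow_succ, pow_succ, pow_succ, mul_apply, mul_apply, Finset.mul_sum]
      refine Finset.sum_le_sum fun w _ => ?_
      calc δ ^ k * δ * ((Q ^ k) z w * Q w y) = (δ ^ k * (Q ^ k) z w) * (δ * Q w y) := by ring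
        _ ≤ _ := mul_le_mul (ih z w) (h w y)
          (mul_nonneg hδ.le (nonneg_of_mem_rowStochastic hQ.stoch))
          (nonneg_of_mem_rowStochastic (pow_mem hst k))
  obtain ⟨k, hk⟩ := hQ.primitive
  exact ⟨k, fun s y => (mul_pos (pow_pos hδ k) (hk s y)).trans_le (hpow k s y)⟩

/-- Changing one row of the matrix by a factor of at most `ρ` changes the stationary distribution
by a factor of at most `ρ ^ 2`. -/
lemma IsErgodic.stationary_le_of_row {Q Q' : Matrix S S ℝ} (hQ : IsErgodic Q)
    (hQ' : IsErgodic Q') {d d' : S → ℝ} (hd : IsStationary Q d) (hd' : IsStationary Q' d')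
    {ρ : ℝ} (hρ1 : 1 ≤ ρ) {x : S} (hrow : ∀ z ≠ x, Q' z = Q z)
    (hρ : ∀ y, Q' x y ≤ ρ * Q x y ∧ Q x y ≤ ρ * Q' x y) (y : S) : d' y ≤ ρ ^ 2 * d y := by
  have hx := hQ.stationary_pos hd x
  have hx' := hQ'.stationary_pos hd' x
  have h1 := hQ.stationary_ratio_le hd hd' hx hx' hρ1 hrow fun y => (hρ y).1
  have h2 := hQ'.stationary_ratio_le hd' hd hx' hx hρ1 (fun z hz => (hrow z hz).symm)
    fun y => (hρ y).2
  -- Summing the reversed ratio bound over all states compares the normalizations, 1 / d x ≤ ρ / d'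
  -- x; this is the second factor ρ.
  have h3 : d' x ≤ ρ * d x := by
    have := Finset.sum_le_sum fun y (_ : y ∈ Finset.univ) => h2 y
    rw [← Finset.mul_sum, ← Finset.sum_div, ← Finset.sum_div, hd.sum_one, hd'.sum_one] at this
    rw [mul_one_div, div_le_div_iff₀ hx hx'] at this
    linarith
  have h4 := h1 y
  rw [div_le_iff₀ hx'] at h4
  calc d' y ≤ ρ * (d y / d x) * d' x := h4
    _ ≤ ρ * (d y / d x) * (ρ * d x) := mul_le_mul_of_nonneg_left h3
        (mul_nonneg (by linarith) (div_nonneg (hd.nonneg y) hx.le))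
    _ = ρ ^ 2 * d y := by field_simp

/-- Changing the rows in `F` of the matrix entrywise by a factor of at most `ρ` changes the
stationary distribution by a factor of at most `ρ ^ (2 * #F)`. -/
lemma IsErgodic.stationary_le [Nonempty S] {ρ : ℝ} (hρ1 : 1 ≤ ρ) {Q' : Matrix S S ℝ}
    (hQ' : IsErgodic Q') {d' : S → ℝ} (hd' : IsStationary Q' d') (F : Finset S) :
    ∀ {Q : Matrix S S ℝ} (_ : IsErgodic Q) {d : S → ℝ} (_ : IsStationary Q d)
      (_ : ∀ z ∉ F, Q' z = Q z) (_ : ∀ z y, Q' z y ≤ ρ * Q z y ∧ Q z y ≤ ρ * Q' z y) (y : S),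
      d' y ≤ ρ ^ (2 * F.card) * d y := by
  induction F using Finset.induction_on with
  | empty =>
    intro Q hQ d hd hF hρ y
    have : Q' = Q := funext fun z => hF z (by simp)
    subst this
    rw [hQ.stationary_unique hd hd']
    simp
  | insert x F hx ih =>
    intro Q hQ d hd hF hρ y
    have hρ0 : 0 < ρ := by linarith
    -- `R` replaces only row `x`: passing from `Q` to `R` costs ρ², and `R` differs from `Q'` only
    -- in the rows of `F`.
    set R : Matrix S S ℝ := fun z => if z = x then Q' z else Q z with hR
    have hRx : R x = Q' x := by simp [hR]
    have hRne : ∀ z ≠ x, R z = Q z := fun z hz => by simp [hR, hz]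
    have hRst : R ∈ rowStochastic ℝ S := by
      rw [mem_rowStochastic_iff_sum]
      constructor
      · intro z y
        by_cases hz : z = x
        · rw [hz, hRx]; exact nonneg_of_mem_rowStochastic hQ'.stoch
        · rw [hRne z hz]; exact nonneg_of_mem_rowStochastic hQ.stoch
      · intro z
        by_cases hz : z = x
        · rw [hz, hRx]; exact sum_row_of_mem_rowStochastic hQ'.stoch x
        · rw [hRne z hz]; exact sum_row_of_mem_rowStochastic hQ.stoch z
    have hnn : ∀ z y, 0 ≤ Q' z y := fun z y => nonneg_of_mem_rowStochastic hQ'.stoch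
    have hRerg : IsErgodic R := hQ'.of_le hRst (inv_pos.2 hρ0) fun z y => by
      rw [inv_mul_le_iff₀ hρ0]
      by_cases hz : z = x
      · rw [hz, hRx]; nlinarith [hnn x y]
      · rw [hRne z hz]; exact (hρ z y).1
    obtain ⟨e, he⟩ := hRerg.exists_stationary
    have h1 := hQ.stationary_le_of_row hRerg hd he hρ1 hRne
      (fun y => by rw [hRx]; exact hρ x y) y
    have h2 := ih hRerg he (fun z hz => by
      by_cases hzx : z = x
      · rw [hzx, hRx]
      · rw [hRne z hzx]; exact hF z (by simp [hz, hzx])) (fun z y => by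
      by_cases hz : z = x
      · rw [hz, hRx]; constructor <;> nlinarith [hnn x y]
      · rw [hRne z hz]; exact hρ z y) y
    rw [Finset.card_insert_of_notMem hx, mul_add, pow_add, mul_assoc]
    exact h2.trans (mul_le_mul_of_nonneg_left h1 (pow_nonneg hρ0.le _))

end Stochastic

end MAC

namespace MAC

open Matrix

/-! ### Probability mass functions on finite types -/

lemma toReal_bind_apply {X Y : Type*} [Fintype X] (p : PMF X) (q : X → PMF Y) (y : Y) :
    (p.bind q y).toReal = ∑ x, (p x).toReal * (q x y).toReal := by
  rw [PMF.bind_apply, tsum_fintype, ENNReal.toReal_sum fun x _ =>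
    ENNReal.mul_ne_top (p.apply_ne_top x) ((q x).apply_ne_top y)]
  simp only [ENNReal.toReal_mul]

lemma sum_toReal {X : Type*} [Fintype X] (p : PMF X) : ∑ x, (p x).toReal = 1 := by
  rw [← ENNReal.toReal_sum fun x _ => p.apply_ne_top x, ← tsum_fintype (L := .unconditional X),
    p.tsum_coe, ENNReal.toReal_one]

/-! ### The chain induced by a policy -/

namespace MDP

variable {S A : Type*} (M : MDP S A) (p : Policy S A) [Fintype S]

/-- The transition matrix of the chain that the policy induces. -/
noncomputable def transMatrix : Matrix S S ℝ := fun s y => (M.chain p s y).toReal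

variable [DecidableEq S]

lemma transMatrix_stoch : M.transMatrix p ∈ rowStochastic ℝ S :=
  mem_rowStochastic_iff_sum.2 ⟨fun _ _ => ENNReal.toReal_nonneg, fun _ => sum_toReal _⟩

lemma toReal_nStep (t : ℕ) (s y : S) :
    (M.nStep p t s y).toReal = (M.transMatrix p ^ t) s y := by
  induction t generalizing y with
  | zero =>
    by_cases h : y = s
    · simp [nStep, h]
    · simp [nStep, h, one_apply_ne' h]
  | succ t ih =>
    rw [nStep, toReal_bind_apply, pow_succ, mul_apply]
    simp only [ih]
    rfl

variable {M p}

lemma Ergodic.isErgodic (h : M.Ergodic p) : IsErgodic (M.transMatrix p) := by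
  obtain ⟨k, hk⟩ := h
  refine ⟨M.transMatrix_stoch p, k, fun s y => ?_⟩
  rw [← toReal_nStep]
  exact ENNReal.toReal_pos (hk s y) (PMF.apply_ne_top _ _)

lemma tendsto_stateLaw (h : M.Ergodic p) {d : S → ℝ} (hd : IsStationary (M.transMatrix p) d)
    (y : S) : Tendsto (fun t => (M.stateLaw p t y).toReal) atTop (𝓝 (d y)) := by
  have h1 : d y = ∑ s, (M.μ₀ s).toReal * d y := by
    rw [← Finset.sum_mul, sum_toReal, one_mul]
  rw [h1]
  simp only [stateLaw, toReal_bind_apply, toReal_nStep]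
  exact tendsto_finsetSum _ fun s _ => (h.isErgodic.tendsto hd s y).const_mul _

lemma stationary_eq (h : M.Ergodic p) {d : S → ℝ} (hd : IsStationary (M.transMatrix p) d) :
    M.stationary p = d := funext fun y => by
  simpa only [stationary, one_div] using (tendsto_stateLaw h hd y).cesaro.limUnder_eq

lemma isStationary_stationary [Nonempty S] (h : M.Ergodic p) :
    IsStationary (M.transMatrix p) (M.stationary p) := by
  obtain ⟨d, hd⟩ := h.isErgodic.exists_stationary
  rwa [stationary_eq h hd]

lemma avgReward_eq [Nonempty S] [Fintype A] (h : M.Ergodic p) :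
    M.avgReward p = ∑ s, M.stationary p s * M.meanReward p s := by
  have hd := isStationary_stationary h
  have hu : Tendsto (fun t => ∑ s, (M.stateLaw p t s).toReal * M.meanReward p s) atTop
      (𝓝 (∑ s, M.stationary p s * M.meanReward p s)) :=
    tendsto_finsetSum _ fun s _ => (tendsto_stateLaw h hd s).mul_const _
  -- The average has T + 1 terms but is divided by T; the extra term over T tends to 0.
  have h0 := (tendsto_inv_atTop_nhds_zero_nat (𝕜 := ℝ)).mul hu
  have := hu.cesaro.add h0
  rw [zero_mul, add_zero] at this
  refine Tendsto.limUnder_eq (this.congr fun T => ?_)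
  rw [Finset.sum_range_succ, one_div, mul_add]

/-- At the mixing time the rows of the transition matrix are within total variation distance
`1 / 2` of each other. -/
lemma mixingTime_spec [Nonempty S] (h : M.Ergodic p) : 1 ≤ M.mixingTime p ∧
    ∀ s s', ∑ y, |(M.transMatrix p ^ M.mixingTime p) s y
      - (M.transMatrix p ^ M.mixingTime p) s' y| ≤ 2 * (1 / 2) := by
  have hd := isStationary_stationary h
  -- The infimum of the empty set of naturals is 0, so the mixing time has its meaning only once the
  -- set is nonempty.
  have hne : {t : ℕ | 1 ≤ t ∧ M.mixDist p t ≤ 1 / 4}.Nonempty := by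
    have hs : ∀ s, Tendsto (fun t => (1 / 2 : ℝ) *
        ∑ y, |(M.nStep p t s y).toReal - M.stationary p y|) atTop (𝓝 0) := fun s => by
      have : Tendsto (fun t => (1 / 2 : ℝ) *
        ∑ y, |(M.nStep p t s y).toReal - M.stationary p y|) atTop (𝓝 (1 / 2 * ∑ _y : S, |0|)) := by
        refine (tendsto_finsetSum _ fun y _ => Tendsto.abs ?_).const_mul _
        simp only [toReal_nStep]
        simpa using (h.isErgodic.tendsto hd s y).sub_const (M.stationary p y)
      simpa using this
    have hev := (eventually_all.2 fun s => (hs s).eventually_le_const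
      (by norm_num : (0 : ℝ) < 1 / 4)).and (eventually_ge_atTop 1)
    obtain ⟨t, ht, ht1⟩ := hev.exists
    exact ⟨t, ht1, ciSup_le ht⟩
  obtain ⟨h1, h2⟩ := Nat.sInf_mem hne
  refine ⟨h1, fun s s' => ?_⟩
  have hb : ∀ s, ∑ y, |(M.transMatrix p ^ M.mixingTime p) s y - M.stationary p y| ≤ 1 / 2 :=
    fun s => by
      have := (le_ciSup (Finite.bddAbove_range fun s => (1 / 2 : ℝ) *
        ∑ y, |(M.nStep p (M.mixingTime p) s y).toReal - M.stationary p y|) s).trans h2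
      simp only [toReal_nStep] at this
      linarith
  calc _ ≤ ∑ y, (|(M.transMatrix p ^ M.mixingTime p) s y - M.stationary p y|
        + |(M.transMatrix p ^ M.mixingTime p) s' y - M.stationary p y|) := by
        refine Finset.sum_le_sum fun y _ => ?_
        rw [abs_sub_comm ((M.transMatrix p ^ M.mixingTime p) s' y)]
        exact abs_sub_le _ _ _
    _ ≤ 2 * (1 / 2) := by
        rw [Finset.sum_add_distrib]
        linarith [hb s, hb s']

/-! ### Mixing-time bounds and perturbation of the average reward. -/

lemma sum_half_pow_div_le {k : ℕ} (hk : k ≠ 0) (N : ℕ) :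
    ∑ t ∈ Finset.range N, (1 / 2 : ℝ) ^ (t / k) ≤ 2 * k := by
  have hblock : ∀ N : ℕ, ∑ t ∈ Finset.range (k * N), (1 / 2 : ℝ) ^ (t / k)
      = k * ∑ i ∈ Finset.range N, (1 / 2 : ℝ) ^ i := fun N => by
    induction N with
    | zero => simp
    | succ N ih =>
      rw [mul_add, mul_one, Finset.sum_range_add, ih, Finset.sum_range_succ, mul_add]
      congr 1
      rw [Finset.sum_congr rfl fun i hi => ?_, Finset.sum_const, Finset.card_range, nsmul_eq_mul]
      rw [Nat.mul_add_div (Nat.pos_of_ne_zero hk), Nat.div_eq_of_lt (Finset.mem_range.1 hi),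
        add_zero]
  calc ∑ t ∈ Finset.range N, (1 / 2 : ℝ) ^ (t / k)
      ≤ ∑ t ∈ Finset.range (k * N), (1 / 2 : ℝ) ^ (t / k) :=
        Finset.sum_le_sum_of_subset_of_nonneg
          (Finset.range_subset_range.2 (Nat.le_mul_of_pos_left N (Nat.pos_of_ne_zero hk)))
          fun _ _ _ => by positivity
    _ = k * ∑ i ∈ Finset.range N, (1 / 2 : ℝ) ^ i := hblock N
    _ ≤ k * 2 := by
        gcongr
        exact sum_geometric_two_le N
    _ = 2 * k := by ring

/-- The total deviation of `P ^ t f` from the stationary mean is at most twice the mixing time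
times the oscillation of `f`. -/
lemma sum_abs_sub_stationary_le [Nonempty S] (h : M.Ergodic p) {f : S → ℝ} {K : ℝ}
    (hf : OscLE f K) (s : S) (N : ℕ) :
    ∑ t ∈ Finset.range N, |(M.transMatrix p ^ t *ᵥ f) s - ∑ y, M.stationary p y * f y|
      ≤ 2 * M.mixingTime p * K := by
  obtain ⟨h1, h2⟩ := mixingTime_spec h
  have hK : 0 ≤ K := by simpa using hf s s
  calc _ ≤ ∑ t ∈ Finset.range N, (1 / 2 : ℝ) ^ (t / M.mixingTime p) * K :=
        Finset.sum_le_sum fun t _ => (isStationary_stationary h).abs_sub_le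
          (hf.mulVec_pow_div (M.transMatrix_stoch p) h2 t) s
    _ ≤ 2 * M.mixingTime p * K := by
        rw [← Finset.sum_mul]
        exact mul_le_mul_of_nonneg_right (sum_half_pow_div_le (by omega) N) hK

variable [Fintype A]

omit [Fintype S] [DecidableEq S] in
lemma meanReward_mem {rmax : ℝ} (hr : ∀ s a, 0 ≤ M.r s a ∧ M.r s a ≤ rmax) (s : S) :
    0 ≤ M.meanReward p s ∧ M.meanReward p s ≤ rmax := by
  refine ⟨Finset.sum_nonneg fun a _ => mul_nonneg ENNReal.toReal_nonneg (hr s a).1, ?_⟩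
  calc M.meanReward p s ≤ ∑ a, (p s a).toReal * rmax :=
        Finset.sum_le_sum fun a _ => mul_le_mul_of_nonneg_left (hr s a).2 ENNReal.toReal_nonneg
    _ = rmax := by rw [← Finset.sum_mul, sum_toReal, one_mul]

lemma avgReward_mem [Nonempty S] (h : M.Ergodic p) {rmax : ℝ}
    (hr : ∀ s a, 0 ≤ M.r s a ∧ M.r s a ≤ rmax) :
    0 ≤ M.avgReward p ∧ M.avgReward p ≤ rmax := by
  rw [avgReward_eq h]
  have hd := isStationary_stationary h
  refine ⟨Finset.sum_nonneg fun s _ => mul_nonneg (hd.nonneg s) (meanReward_mem hr s).1, ?_⟩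
  calc _ ≤ ∑ s, M.stationary p s * rmax :=
        Finset.sum_le_sum fun s _ => mul_le_mul_of_nonneg_left (meanReward_mem hr s).2
          (hd.nonneg s)
    _ = rmax := by rw [← Finset.sum_mul, hd.sum_one, one_mul]

/-- Changing all action probabilities by a factor of at most `ρ` changes the average reward by a
factor of at most `ρ ^ (2 * #S + 1)`. -/
lemma avgReward_le_of_policy_le [Nonempty S] {p' : Policy S A} (h : M.Ergodic p)
    (h' : M.Ergodic p') (hr : ∀ s a, 0 ≤ M.r s a) {ρ : ℝ} (hρ1 : 1 ≤ ρ)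
    (hρ : ∀ s a, (p' s a).toReal ≤ ρ * (p s a).toReal ∧ (p s a).toReal ≤ ρ * (p' s a).toReal) :
    M.avgReward p' ≤ ρ ^ (2 * Fintype.card S + 1) * M.avgReward p := by
  have hd := isStationary_stationary h
  have hd' := isStationary_stationary h'
  have hρ0 : 0 ≤ ρ := by linarith
  have hle : ∀ {p p' : Policy S A}, (∀ s a, (p' s a).toReal ≤ ρ * (p s a).toReal) →
      ∀ s y, M.transMatrix p' s y ≤ ρ * M.transMatrix p s y := fun {p p'} hp s y => by
    simp only [transMatrix, chain, toReal_bind_apply]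
    rw [Finset.mul_sum]
    refine Finset.sum_le_sum fun a _ => ?_
    rw [← mul_assoc]
    exact mul_le_mul_of_nonneg_right (hp s a) ENNReal.toReal_nonneg
  have hstat := IsErgodic.stationary_le hρ1 h'.isErgodic hd' Finset.univ h.isErgodic hd
    (fun z hz => absurd (Finset.mem_univ z) hz)
    fun z y => ⟨hle (fun s a => (hρ s a).1) z y, hle (fun s a => (hρ s a).2) z y⟩
  rw [avgReward_eq h, avgReward_eq h', Finset.mul_sum]
  refine Finset.sum_le_sum fun s _ => ?_
  have hm : M.meanReward p' s ≤ ρ * M.meanReward p s := by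
    rw [meanReward, meanReward, Finset.mul_sum]
    refine Finset.sum_le_sum fun a _ => ?_
    rw [← mul_assoc]
    exact mul_le_mul_of_nonneg_right (hρ s a).1 (hr s a)
  have hm0 : 0 ≤ M.meanReward p' s :=
    Finset.sum_nonneg fun a _ => mul_nonneg ENNReal.toReal_nonneg (hr s a)
  calc _ ≤ (ρ ^ (2 * Fintype.card S) * M.stationary p s) * (ρ * M.meanReward p s) :=
        mul_le_mul (hstat s) hm hm0 (mul_nonneg (pow_nonneg hρ0 _) (hd.nonneg s))
    _ = _ := by ring

end MDP

/-! ### Lipschitz continuity of the average reward -/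

namespace Config

variable {S A : Type*} {q m : ℕ} {c : Config S A q m}

/-- The mean value inequality for the log-probability, exponentiated. -/
lemma BoundedScore.policy_le {B : ℝ} (h : c.BoundedScore B) (θ θ' : Vec q) (s : S) (a : A) :
    (c.policy θ' s a).toReal ≤ Real.exp (B * ‖θ' - θ‖) * (c.policy θ s a).toReal := by
  obtain ⟨hne, hdiff, hB⟩ := h s a
  have hpos : ∀ θ, 0 < (c.policy θ s a).toReal := fun θ =>
    ENNReal.toReal_pos (hne θ) (PMF.apply_ne_top _ _)
  have hmv := convex_univ.norm_image_sub_le_of_norm_fderiv_le (𝕜 := ℝ)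
    (f := fun θ => Real.log (c.policy θ s a).toReal) (C := B)
    (fun x _ => hdiff x) (fun x _ => by
      have := hB x
      rwa [score, gradient, LinearIsometryEquiv.norm_map] at this)
    (Set.mem_univ θ) (Set.mem_univ θ')
  have h1 := (le_abs_self _).trans hmv
  rw [← Real.exp_log (hpos θ'), ← Real.exp_log (hpos θ), ← Real.exp_add, Real.exp_le_exp]
  linarith

/-- The average reward is Lipschitz in the parameter, with a constant that does not depend on the
mixing times. -/
lemma abs_J_sub_le [Fintype S] [Fintype A] [Nonempty S] {B rmax : ℝ} (hB0 : 0 ≤ B)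
    (hB : c.BoundedScore B)
    (hr : ∀ s a, 0 ≤ c.mdp.r s a ∧ c.mdp.r s a ≤ rmax)
    (herg : ∀ θ, c.mdp.Ergodic (c.policy θ)) (θ θ' : Vec q) :
    |c.J θ' - c.J θ| ≤ (2 * Fintype.card S + 1) * B * rmax * ‖θ' - θ‖ := by
  classical
  have key : ∀ θ θ' : Vec q,
      c.J θ' - c.J θ ≤ (2 * Fintype.card S + 1) * B * rmax * ‖θ' - θ‖ := fun θ θ' => by
    set N : ℝ := 2 * Fintype.card S + 1 with hN
    have hρ1 : 1 ≤ Real.exp (B * ‖θ' - θ‖) := Real.one_le_exp (by positivity)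
    have h1 : c.J θ' ≤ _ := MDP.avgReward_le_of_policy_le (herg θ) (herg θ')
      (fun s a => (hr s a).1) hρ1 fun s a => ⟨hB.policy_le θ θ' s a, by
        rw [norm_sub_rev]; exact hB.policy_le θ' θ s a⟩
    rw [← Real.exp_nat_mul] at h1
    change _ ≤ _ * c.J θ at h1
    push_cast at h1
    rw [← hN] at h1
    obtain ⟨h0, hmax⟩ := MDP.avgReward_mem (herg θ') hr
    change 0 ≤ c.J θ' at h0
    change c.J θ' ≤ rmax at hmax
    set u := N * (B * ‖θ' - θ‖) with hu
    have hN0 : 0 ≤ N := by positivity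
    have hu0 : 0 ≤ u := by positivity
    -- From J(θ') ≤ e^u J(θ) and 1 - u ≤ e^(-u). With J(θ') ≤ rmax the multiplicative bound becomes
    -- additive for all u, with no smallness condition.
    have h2 : (1 - u) * c.J θ' ≤ c.J θ := by
      have h3 : Real.exp (-u) * c.J θ' ≤ c.J θ := by
        rw [Real.exp_neg, inv_mul_le_iff₀ (Real.exp_pos u)]
        exact h1
      have h4 := Real.add_one_le_exp (-u)
      nlinarith
    have h5 : u * c.J θ' ≤ u * rmax := mul_le_mul_of_nonneg_left hmax hu0
    calc c.J θ' - c.J θ ≤ u * rmax := by linarith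
      _ = _ := by rw [hu]; ring
  rw [abs_le]
  refine ⟨?_, key θ θ'⟩
  have := key θ' θ
  rw [norm_sub_rev] at this
  linarith

end Config

end MAC

namespace MAC

open Matrix

/-! ### Expectations of discrete random variables -/

/-- `F` is almost surely bounded. -/
def BddOn {X : Type*} (p : PMF X) (F : X → ℝ) : Prop := ∃ K, ∀ x ∈ p.support, |F x| ≤ K

section Expect

variable {X Y : Type*} {p : PMF X} {F G : X → ℝ}

lemma BddOn.const (p : PMF X) (a : ℝ) : BddOn p fun _ => a := ⟨|a|, fun _ _ => le_rfl⟩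

lemma BddOn.add (hF : BddOn p F) (hG : BddOn p G) : BddOn p fun x => F x + G x := by
  obtain ⟨K, hK⟩ := hF
  obtain ⟨L, hL⟩ := hG
  exact ⟨K + L, fun x hx => (abs_add_le _ _).trans (add_le_add (hK x hx) (hL x hx))⟩

lemma BddOn.mul (hF : BddOn p F) (hG : BddOn p G) : BddOn p fun x => F x * G x := by
  obtain ⟨K, hK⟩ := hF
  obtain ⟨L, hL⟩ := hG
  refine ⟨K * L, fun x hx => ?_⟩
  rw [abs_mul]
  exact mul_le_mul (hK x hx) (hL x hx) (abs_nonneg _) ((abs_nonneg _).trans (hK x hx))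

lemma BddOn.const_mul (a : ℝ) (hF : BddOn p F) : BddOn p fun x => a * F x :=
  (BddOn.const p a).mul hF

lemma BddOn.of_finite (h : p.support.Finite) (F : X → ℝ) : BddOn p F := by
  obtain ⟨K, hK⟩ := (h.image fun x => |F x|).bddAbove
  exact ⟨K, fun x hx => hK (Set.mem_image_of_mem _ hx)⟩

lemma summable_toReal (p : PMF X) : Summable fun x => (p x).toReal :=
  ENNReal.summable_toReal p.tsum_coe_ne_top

lemma tsum_toReal (p : PMF X) : ∑' x, (p x).toReal = 1 := by
  rw [← ENNReal.tsum_toReal_eq p.apply_ne_top, p.tsum_coe, ENNReal.toReal_one]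

lemma BddOn.summable (hF : BddOn p F) : Summable fun x => (p x).toReal * F x := by
  obtain ⟨K, hK⟩ := hF
  refine Summable.of_norm_bounded ((summable_toReal p).mul_right K) fun x => ?_
  rw [norm_mul, Real.norm_of_nonneg ENNReal.toReal_nonneg]
  by_cases hx : p x = 0
  · simp [hx]
  · exact mul_le_mul_of_nonneg_left (hK x ((p.mem_support_iff x).2 hx)) ENNReal.toReal_nonneg

lemma expect_congr (h : ∀ x ∈ p.support, F x = G x) : expect p F = expect p G := by
  refine tsum_congr fun x => ?_
  by_cases hx : p x = 0
  · simp [hx]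
  · rw [h x ((p.mem_support_iff x).2 hx)]

lemma expect_mono (hF : BddOn p F) (hG : BddOn p G) (h : ∀ x ∈ p.support, F x ≤ G x) :
    expect p F ≤ expect p G := by
  refine hF.summable.tsum_le_tsum (fun x => ?_) hG.summable
  by_cases hx : p x = 0
  · simp [hx]
  · exact mul_le_mul_of_nonneg_left (h x ((p.mem_support_iff x).2 hx)) ENNReal.toReal_nonneg

lemma expect_const (p : PMF X) (a : ℝ) : expect p (fun _ => a) = a := by
  rw [expect, tsum_mul_right, tsum_toReal, one_mul]

lemma expect_add (hF : BddOn p F) (hG : BddOn p G) :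
    expect p (fun x => F x + G x) = expect p F + expect p G := by
  simp only [expect, mul_add]
  exact hF.summable.tsum_add hG.summable

lemma expect_const_mul (p : PMF X) (a : ℝ) (F : X → ℝ) :
    expect p (fun x => a * F x) = a * expect p F := by
  simp only [expect, ← tsum_mul_left]
  exact tsum_congr fun x => by ring

lemma expect_sub (hF : BddOn p F) (hG : BddOn p G) :
    expect p (fun x => F x - G x) = expect p F - expect p G := by
  simp only [expect, mul_sub]
  exact hF.summable.tsum_sub hG.summable

lemma expect_nonneg (h : ∀ x ∈ p.support, 0 ≤ F x) : 0 ≤ expect p F := by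
  refine tsum_nonneg fun x => ?_
  by_cases hx : p x = 0
  · simp [hx]
  · exact mul_nonneg ENNReal.toReal_nonneg (h x ((p.mem_support_iff x).2 hx))

lemma abs_expect_le {K : ℝ} (h : ∀ x ∈ p.support, |F x| ≤ K) : |expect p F| ≤ K := by
  have hb : BddOn p F := ⟨K, h⟩
  rw [abs_le]
  constructor
  · rw [← expect_const p (-K)]
    exact expect_mono (BddOn.const p _) hb fun x hx => (abs_le.1 (h x hx)).1
  · rw [← expect_const p K]
    exact expect_mono hb (BddOn.const p _) fun x hx => (abs_le.1 (h x hx)).2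

lemma expect_pure (x : X) (F : X → ℝ) : expect (PMF.pure x) F = F x := by
  classical
  rw [expect, tsum_eq_single x fun y hy => by simp [PMF.pure_apply_of_ne x y hy]]
  simp

lemma expect_fintype [Fintype X] (p : PMF X) (F : X → ℝ) :
    expect p F = ∑ x, (p x).toReal * F x := tsum_fintype _

lemma expect_bind {q : X → PMF Y} {F : Y → ℝ} (hF : BddOn (p.bind q) F) :
    expect (p.bind q) F = expect p fun x => expect (q x) F := by
  obtain ⟨K, hK⟩ := hF
  have hsum : Summable fun z : X × Y => (p z.1).toReal * (q z.1 z.2).toReal := by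
    have : Summable fun z : X × Y => (p z.1 * q z.1 z.2).toReal := by
      refine ENNReal.summable_toReal ?_
      rw [ENNReal.tsum_prod (f := fun x y => p x * q x y)]
      simp [ENNReal.tsum_mul_left, PMF.tsum_coe]
    simpa only [ENNReal.toReal_mul] using this
  -- Fubini needs absolute summability. `F` is bounded only on the support, and elsewhere its weight
  -- is zero.
  have hsum' : Summable (Function.uncurry fun (y : Y) (x : X) =>
      (p x).toReal * ((q x y).toReal * F y)) := by
    rw [← (Equiv.prodComm X Y).summable_iff]
    refine Summable.of_norm_bounded (hsum.mul_right K) fun z => ?_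
    simp only [Function.comp_apply, Equiv.prodComm_apply, Function.uncurry, Prod.fst_swap,
      Prod.snd_swap]
    rw [← mul_assoc, norm_mul, Real.norm_of_nonneg (by positivity)]
    by_cases h : p z.1 = 0
    · simp [h]
    by_cases h' : q z.1 z.2 = 0
    · simp [h']
    · exact mul_le_mul_of_nonneg_left (hK _ ((PMF.mem_support_bind_iff _ _ _).2
        ⟨z.1, (p.mem_support_iff _).2 h, (PMF.mem_support_iff _ _).2 h'⟩)) (by positivity)
  simp only [expect, ← tsum_mul_left]
  rw [hsum'.tsum_comm]
  refine tsum_congr fun y => ?_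
  rw [PMF.bind_apply, ENNReal.tsum_toReal_eq fun x =>
    ENNReal.mul_ne_top (p.apply_ne_top x) ((q x).apply_ne_top y), ← tsum_mul_right]
  exact tsum_congr fun x => by rw [ENNReal.toReal_mul, mul_assoc]

lemma BddOn.of_map {f : X → Y} {F : Y → ℝ} (hF : BddOn p fun x => F (f x)) :
    BddOn (p.map f) F := by
  obtain ⟨K, hK⟩ := hF
  refine ⟨K, fun y hy => ?_⟩
  obtain ⟨x, hx, rfl⟩ := (PMF.mem_support_map_iff _ _ _).1 hy
  exact hK x hx

lemma expect_map {f : X → Y} {F : Y → ℝ} (hF : BddOn p fun x => F (f x)) :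
    expect (p.map f) F = expect p fun x => F (f x) := by
  have := hF.of_map
  rw [← PMF.bind_pure_comp] at this ⊢
  rw [expect_bind this]
  simp only [Function.comp_apply, expect_pure]

end Expect

/-! ### Moments along a trajectory -/

/-- The sum of `ρ (s, a)` over a list of transitions. -/
def total {S A : Type*} (ρ : S → A → ℝ) (z : List (Sample S A)) : ℝ :=
  (z.map fun y => ρ y.1 y.2.1).sum

lemma abs_total_le {S A : Type*} {ρ : S → A → ℝ} {K : ℝ} (hρ : ∀ s a, |ρ s a| ≤ K)
    (z : List (Sample S A)) : |total ρ z| ≤ z.length * K := by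
  induction z with
  | nil => simp [total]
  | cons y z ih =>
    have : total ρ (y :: z) = ρ y.1 y.2.1 + total ρ z := by simp [total]
    rw [this, List.length_cons]
    push_cast
    linarith [abs_add_le (ρ y.1 y.2.1) (total ρ z), hρ y.1 y.2.1]

namespace Config

variable {S A : Type*} {q m : ℕ} (c : Config S A q m)

lemma length_of_mem_trajectory {θ : Vec q} {N : ℕ} {s : S} {z : List (Sample S A)}
    (hz : z ∈ (c.trajectory θ N s).support) : z.length = N := by
  induction N generalizing s z with
  | zero => simpa [trajectory] using hz
  | succ N ih =>
    simp only [trajectory, PMF.mem_support_bind_iff, PMF.mem_support_map_iff] at hz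
    obtain ⟨a, -, s', -, l, hl, rfl⟩ := hz
    rw [List.length_cons, ih hl]

variable [Fintype S] [Fintype A]

lemma finite_support_trajectory (θ : Vec q) (N : ℕ) (s : S) :
    (c.trajectory θ N s).support.Finite :=
  (List.finite_length_eq (Sample S A) N).subset fun _ hz => c.length_of_mem_trajectory hz

lemma bddOn_trajectory (θ : Vec q) (N : ℕ) (s : S) (F : List (Sample S A) → ℝ) :
    BddOn (c.trajectory θ N s) F := BddOn.of_finite (c.finite_support_trajectory θ N s) F

/-- The first-step decomposition of an expectation over a trajectory. -/
lemma expect_trajectory_succ (θ : Vec q) (N : ℕ) (s : S) (F : List (Sample S A) → ℝ) :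
    expect (c.trajectory θ (N + 1) s) F = ∑ a, (c.policy θ s a).toReal *
      ∑ s', (c.mdp.P s a s').toReal *
        expect (c.trajectory θ N s') fun l => F ((s, a, s') :: l) := by
  have hb : BddOn (c.trajectory θ (N + 1) s) F := c.bddOn_trajectory θ (N + 1) s F
  obtain ⟨K, hK⟩ := hb
  have hb2 : ∀ a ∈ (c.policy θ s).support, BddOn ((c.mdp.P s a).bind fun s' =>
      (c.trajectory θ N s').map fun l => (s, a, s') :: l) F := fun a ha =>
    ⟨K, fun z hz => hK z ((PMF.mem_support_bind_iff _ _ _).2 ⟨a, ha, hz⟩)⟩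
  rw [trajectory] at hK ⊢
  rw [expect_bind ⟨K, hK⟩, expect_congr fun a ha => expect_bind (hb2 a ha)]
  simp only [expect_fintype]
  refine Finset.sum_congr rfl fun a _ => ?_
  congr 1
  refine Finset.sum_congr rfl fun s' _ => ?_
  rw [expect_map (c.bddOn_trajectory θ N s' _)]

/-- The first `M` transitions of a trajectory form a trajectory. -/
lemma expect_trajectory_take (θ : Vec q) {M N : ℕ} (hMN : M ≤ N) (s : S)
    (F : List (Sample S A) → ℝ) :
    expect (c.trajectory θ N s) (fun z => F (z.take M)) = expect (c.trajectory θ M s) F := by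
  induction M generalizing N s F with
  | zero => simp only [List.take_zero, expect_const, trajectory, expect_pure]
  | succ M ih =>
    obtain ⟨N, rfl⟩ : ∃ N', N = N' + 1 := ⟨N - 1, by omega⟩
    rw [expect_trajectory_succ, expect_trajectory_succ]
    simp only [List.take_succ_cons]
    refine Finset.sum_congr rfl fun a _ => ?_
    congr 1
    refine Finset.sum_congr rfl fun s' _ => ?_
    rw [ih (by omega) s' fun l => F ((s, a, s') :: l)]

lemma sum_policy_sum_P (θ : Vec q) (s : S) (g : S → ℝ) :
    ∑ a, (c.policy θ s a).toReal * ∑ s', (c.mdp.P s a s').toReal * g s'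
      = (c.mdp.transMatrix (c.policy θ) *ᵥ g) s := by
  simp only [mulVec, dotProduct, MDP.transMatrix, MDP.chain, toReal_bind_apply, Finset.mul_sum,
    Finset.sum_mul]
  rw [Finset.sum_comm]
  simp only [mul_assoc]

lemma expect_total_succ (θ : Vec q) (ρ : S → A → ℝ) (N : ℕ) (s : S) :
    expect (c.trajectory θ (N + 1) s) (total ρ) = ∑ a, (c.policy θ s a).toReal * ρ s a
      + (c.mdp.transMatrix (c.policy θ) *ᵥ fun s' => expect (c.trajectory θ N s') (total ρ)) s := by
  rw [expect_trajectory_succ, ← sum_policy_sum_P, ← Finset.sum_add_distrib]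
  refine Finset.sum_congr rfl fun a _ => ?_
  rw [← mul_add]
  congr 1
  have h : ρ s a = ∑ s', (c.mdp.P s a s').toReal * ρ s a := by
    rw [← Finset.sum_mul, sum_toReal, one_mul]
  nth_rewrite 1 [h]
  rw [← Finset.sum_add_distrib]
  refine Finset.sum_congr rfl fun s' _ => ?_
  rw [← mul_add, ← expect_const (c.trajectory θ N s') (ρ s a),
    ← expect_add (BddOn.const _ _) (c.bddOn_trajectory θ N s' _)]
  simp [total]

/-- The mean of the accumulated reward. -/
lemma expect_total [DecidableEq S] (θ : Vec q) (ρ : S → A → ℝ) (N : ℕ) (s : S) :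
    expect (c.trajectory θ N s) (total ρ) = ∑ i ∈ Finset.range N,
      (c.mdp.transMatrix (c.policy θ) ^ i *ᵥ
        fun s => ∑ a, (c.policy θ s a).toReal * ρ s a) s := by
  induction N generalizing s with
  | zero => simp [trajectory, expect_pure, total]
  | succ N ih =>
    have h : ∀ i, (c.mdp.transMatrix (c.policy θ) ^ (i + 1) *ᵥ
        fun s => ∑ a, (c.policy θ s a).toReal * ρ s a) s
        = ∑ y, c.mdp.transMatrix (c.policy θ) s y * (c.mdp.transMatrix (c.policy θ) ^ i *ᵥ
          fun s => ∑ a, (c.policy θ s a).toReal * ρ s a) y := fun i => by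
      rw [pow_succ', ← mulVec_mulVec]
      rfl
    rw [expect_total_succ, Finset.sum_range_succ', add_comm]
    simp only [ih, pow_zero, one_mulVec, h]
    rw [Finset.sum_comm]
    simp only [← Finset.mul_sum]
    rfl

/-- If the means of all accumulated rewards are bounded, the second moments grow linearly. -/
lemma expect_total_sq_le (θ : Vec q) {ρ : S → A → ℝ} {K D : ℝ} (hρ : ∀ s a, |ρ s a| ≤ K)
    (hD : ∀ N s, |expect (c.trajectory θ N s) (total ρ)| ≤ D) (N : ℕ) (s : S) :
    expect (c.trajectory θ N s) (fun z => total ρ z ^ 2) ≤ N * (K ^ 2 + 2 * K * D) := by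
  induction N generalizing s with
  | zero => simp [trajectory, expect_pure, total]
  | succ N ih =>
    have hstep : ∀ a s', expect (c.trajectory θ N s') (fun l => total ρ ((s, a, s') :: l) ^ 2)
        ≤ (N + 1) * (K ^ 2 + 2 * K * D) := fun a s' => by
      have h1 : ∀ l, total ρ ((s, a, s') :: l) ^ 2
          = (ρ s a ^ 2 + 2 * ρ s a * total ρ l) + total ρ l ^ 2 := fun l => by
        simp [total]; ring
      simp only [h1]
      have hb := c.bddOn_trajectory θ N s'
      rw [expect_add (hb _) (hb _), expect_add (hb _) (hb _), expect_const, expect_const_mul]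
      have h2 : ρ s a ^ 2 ≤ K ^ 2 := sq_le_sq' (abs_le.1 (hρ s a)).1 (abs_le.1 (hρ s a)).2
      -- Given the first transition, the cross term involves only the mean of the remaining total,
      -- which is at most D from any state; so each step adds a constant.
      have h3 : ρ s a * expect (c.trajectory θ N s') (total ρ) ≤ K * D :=
        (le_abs_self _).trans (by
          rw [abs_mul]
          exact mul_le_mul (hρ s a) (hD N s') (abs_nonneg _) ((abs_nonneg _).trans (hρ s a)))
      have h4 := ih s'
      linarith
    rw [expect_trajectory_succ]
    push_cast
    calc _ ≤ ∑ a, (c.policy θ s a).toReal * ∑ s', (c.mdp.P s a s').toReal *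
          ((N + 1) * (K ^ 2 + 2 * K * D)) := by
          gcongr with a _ s' _
          exact hstep a s'
      _ = _ := by simp only [← Finset.sum_mul, sum_toReal, one_mul]

end Config

end MAC

namespace MAC

open Matrix

/-! ### The level law -/

lemma expect_levelLaw {F : ℕ → ℝ} (hF : BddOn levelLaw F) :
    expect levelLaw F = ∑' n : ℕ, (1 / 2 : ℝ) ^ (n + 1) * F (n + 1) := by
  have hF' := hF
  obtain ⟨K, hK⟩ := hF
  rw [levelLaw, expect_map ⟨K, fun n hn => hK _ ((PMF.mem_support_map_iff _ _ _).2 ⟨n, hn, rfl⟩)⟩]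
  refine tsum_congr fun n => ?_
  congr 1
  change ((2⁻¹ : ENNReal) ^ (n + 1)).toReal = _
  simp

lemma bddOn_levelLaw_ite (a : ℝ) (G : ℕ → ℝ) (T : ℕ) :
    BddOn levelLaw fun j => a + if 2 ^ j ≤ T then G j else 0 := by
  refine (BddOn.const _ a).add ⟨∑ i ∈ Finset.range T, |G i|, fun j _ => ?_⟩
  dsimp only
  by_cases h : 2 ^ j ≤ T
  · rw [if_pos h]
    -- Only levels with j < 2^j ≤ T contribute, so finitely many values of `G` matter.
    exact Finset.single_le_sum (f := fun i => |G i|) (fun i _ => abs_nonneg _)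
      (Finset.mem_range.2 (Nat.lt_two_pow_self.trans_le h))
  · rw [if_neg h, abs_zero]
    exact Finset.sum_nonneg fun i _ => abs_nonneg _

lemma expect_levelLaw_ite (a : ℝ) (G : ℕ → ℝ) {T : ℕ} (hT : T ≠ 0) :
    expect levelLaw (fun j => a + if 2 ^ j ≤ T then G j else 0)
      = a + ∑ i ∈ Finset.range (Nat.log 2 T), (1 / 2 : ℝ) ^ (i + 1) * G (i + 1) := by
  have hb := bddOn_levelLaw_ite 0 G T
  simp only [zero_add] at hb
  rw [expect_add (BddOn.const _ a) hb, expect_const, expect_levelLaw hb,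
    tsum_eq_sum (s := Finset.range (Nat.log 2 T))]
  · congr 1
    refine Finset.sum_congr rfl fun i hi => ?_
    rw [if_pos]
    exact (Nat.le_log_iff_pow_le one_lt_two hT).1 (Finset.mem_range.1 hi)
  · intro i hi
    rw [if_neg, mul_zero]
    intro h
    exact hi (Finset.mem_range.2 ((Nat.le_log_iff_pow_le one_lt_two hT).2 h))

/-! ### Moments of the multi-level estimator -/

section Estimator

variable {S A : Type*}

lemma levelAvg_const_sub {Z : Type*} (b : ℝ) (F : Z → ℝ) {z : List Z} {i : ℕ}
    (hz : 2 ^ i ≤ z.length) : levelAvg (fun y => b - F y) z i = b - levelAvg F z i := by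
  have h : ∀ l : List Z, (l.map fun y => b - F y).sum = l.length * b - (l.map F).sum := fun l => by
    induction l with
    | nil => simp
    | cons y l ih => simp [ih]; ring
  simp only [levelAvg, smul_eq_mul, h, List.length_take, min_eq_left hz]
  push_cast
  field_simp

/-- Constants cancel in the level difference because the trajectory is long enough for every average
to be a genuine one. -/
lemma mlmc_const_sub {Z : Type*} (b : ℝ) (F : Z → ℝ) {z : List Z} {j T : ℕ}
    (hz : z.length = 2 ^ j) : mlmc T (fun y => b - F y) z j = b - mlmc T F z j := by
  have h : ∀ i ≤ j, 2 ^ i ≤ z.length := fun i hi => by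
    rw [hz]; exact Nat.pow_le_pow_right two_pos hi
  rw [mlmc, mlmc, levelAvg_const_sub b F (h 0 j.zero_le), levelAvg_const_sub b F (h j le_rfl),
    levelAvg_const_sub b F (h (j - 1) (Nat.sub_le _ _))]
  split_ifs
  · simp only [smul_eq_mul]; ring
  · ring

/-- The average of `ρ` over the first `2 ^ j` transitions. -/
noncomputable def levelMean (ρ : S → A → ℝ) (z : List (Sample S A)) (j : ℕ) : ℝ :=
  levelAvg (fun y => ρ y.1 y.2.1) z j

lemma levelMean_eq (ρ : S → A → ℝ) (z : List (Sample S A)) (j : ℕ) :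
    levelMean ρ z j = ((2 : ℝ) ^ j)⁻¹ * total ρ (z.take (2 ^ j)) := rfl

/-- The multi-level estimator of the mean of `ρ`. -/
noncomputable def levelEst (T : ℕ) (ρ : S → A → ℝ) (z : List (Sample S A)) (j : ℕ) : ℝ :=
  mlmc T (fun y => ρ y.1 y.2.1) z j

lemma levelEst_eq (T : ℕ) (ρ : S → A → ℝ) (z : List (Sample S A)) (j : ℕ) :
    levelEst T ρ z j = levelMean ρ z 0 +
      if 2 ^ j ≤ T then (2 : ℝ) ^ j * (levelMean ρ z j - levelMean ρ z (j - 1)) else 0 := rfl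

lemma abs_levelMean_le {ρ : S → A → ℝ} {K : ℝ} (hK : 0 ≤ K) (hρ : ∀ s a, |ρ s a| ≤ K)
    (z : List (Sample S A)) (j : ℕ) : |levelMean ρ z j| ≤ K := by
  rw [levelMean_eq, abs_mul, abs_of_nonneg (by positivity), inv_mul_le_iff₀ (by positivity)]
  refine (abs_total_le hρ _).trans (mul_le_mul_of_nonneg_right ?_ hK)
  have : (z.take (2 ^ j)).length ≤ 2 ^ j := by simp
  exact_mod_cast this

lemma abs_levelEst_le {ρ : S → A → ℝ} {K : ℝ} (hK : 0 ≤ K) (hρ : ∀ s a, |ρ s a| ≤ K) (T : ℕ)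
    (z : List (Sample S A)) (j : ℕ) : |levelEst T ρ z j| ≤ K + T * (2 * K) := by
  rw [levelEst_eq]
  refine (abs_add_le _ _).trans (add_le_add (abs_levelMean_le hK hρ z 0) ?_)
  split_ifs with h
  · rw [abs_mul, abs_of_nonneg (by positivity)]
    have h1 := abs_sub (levelMean ρ z j) (levelMean ρ z (j - 1))
    have h2 := abs_levelMean_le hK hρ z j
    have h3 := abs_levelMean_le hK hρ z (j - 1)
    exact mul_le_mul (by exact_mod_cast h) (by linarith) (abs_nonneg _) (by positivity)
  · rw [abs_zero]; positivity

end Estimator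

namespace Config

variable {S A : Type*} {q m : ℕ} (c : Config S A q m) [Fintype S] [Fintype A]

lemma expect_levelMean (θ : Vec q) (ρ : S → A → ℝ) {i N : ℕ} (h : 2 ^ i ≤ N) (s : S) :
    expect (c.trajectory θ N s) (fun z => levelMean ρ z i)
      = ((2 : ℝ) ^ i)⁻¹ * expect (c.trajectory θ (2 ^ i) s) (total ρ) := by
  simp only [levelMean_eq]
  rw [expect_const_mul, c.expect_trajectory_take θ h s (total ρ)]

lemma expect_levelMean_sq_le (θ : Vec q) {ρ : S → A → ℝ} {V : ℝ} (s : S)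
    (hV : ∀ N, expect (c.trajectory θ N s) (fun z => total ρ z ^ 2) ≤ N * V) {i N : ℕ}
    (h : 2 ^ i ≤ N) :
    expect (c.trajectory θ N s) (fun z => levelMean ρ z i ^ 2) ≤ ((2 : ℝ) ^ i)⁻¹ * V := by
  simp only [levelMean_eq, mul_pow]
  rw [expect_const_mul, c.expect_trajectory_take θ h s fun z => total ρ z ^ 2]
  have h1 := hV (2 ^ i)
  push_cast at h1
  calc _ ≤ (((2 : ℝ) ^ i)⁻¹) ^ 2 * (2 ^ i * V) := mul_le_mul_of_nonneg_left h1 (by positivity)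
    _ = _ := by field_simp

/-- The multi-level estimator has the mean of the average over `2 ^ ⌊log₂ Tmax⌋` transitions. -/
lemma expect_levelEst (θ : Vec q) (ρ : S → A → ℝ) {T : ℕ} (hT : T ≠ 0) (s : S) :
    expect levelLaw (fun j => expect (c.trajectory θ (2 ^ j) s) fun z => levelEst T ρ z j)
      = ((2 : ℝ) ^ Nat.log 2 T)⁻¹ * expect (c.trajectory θ (2 ^ Nat.log 2 T) s) (total ρ) := by
  set μ : ℕ → ℝ := fun i => ((2 : ℝ) ^ i)⁻¹ * expect (c.trajectory θ (2 ^ i) s) (total ρ) with hμ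
  have hb := fun j => c.bddOn_trajectory θ (2 ^ j) s
  have h : ∀ j, expect (c.trajectory θ (2 ^ j) s) (fun z => levelEst T ρ z j)
      = μ 0 + if 2 ^ j ≤ T then (2 : ℝ) ^ j * (μ j - μ (j - 1)) else 0 := fun j => by
    simp only [levelEst_eq]
    rw [expect_add (hb _ _) (hb _ _),
      c.expect_levelMean θ ρ (Nat.pow_le_pow_right two_pos j.zero_le)]
    congr 1
    split_ifs
    · rw [expect_const_mul, expect_sub (hb _ _) (hb _ _), c.expect_levelMean θ ρ le_rfl,
        c.expect_levelMean θ ρ (Nat.pow_le_pow_right two_pos (Nat.sub_le _ _))]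
    · rw [expect_const]
  simp only [h]
  rw [expect_levelLaw_ite _ _ hT]
  -- The probability of the level cancels the weight of the correction, and the sum telescopes.
  have h2 : ∀ i, (1 / 2 : ℝ) ^ (i + 1) * (2 ^ (i + 1) * (μ (i + 1) - μ (i + 1 - 1)))
      = μ (i + 1) - μ i := fun i => by
    rw [← mul_assoc, ← mul_pow]; norm_num
  simp only [h2, Finset.sum_range_sub]
  ring

/-- The second moment of the multi-level estimator grows logarithmically in `Tmax`. -/
lemma expect_levelEst_sq_le (θ : Vec q) {ρ : S → A → ℝ} {K V : ℝ} (hK : 0 ≤ K)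
    (hρ : ∀ s a, |ρ s a| ≤ K) (s : S)
    (hV : ∀ N, expect (c.trajectory θ N s) (fun z => total ρ z ^ 2) ≤ N * V)
    {T : ℕ} (hT : T ≠ 0) :
    expect levelLaw (fun j => expect (c.trajectory θ (2 ^ j) s) fun z => levelEst T ρ z j ^ 2)
      ≤ 2 * K ^ 2 + 12 * V * Nat.log 2 T := by
  have hb := fun j => c.bddOn_trajectory θ (2 ^ j) s
  have h : ∀ j ∈ levelLaw.support,
      expect (c.trajectory θ (2 ^ j) s) (fun z => levelEst T ρ z j ^ 2)
      ≤ 2 * K ^ 2 + if 2 ^ j ≤ T then (2 : ℝ) ^ j * (12 * V) else 0 := fun j hj => by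
    have hj0 : j ≠ 0 := by
      rintro rfl
      obtain ⟨n, -, hn⟩ := (PMF.mem_support_map_iff _ _ _).1 hj
      exact Nat.succ_ne_zero n hn
    have hpt : ∀ z, levelEst T ρ z j ^ 2 ≤ 2 * K ^ 2 + if 2 ^ j ≤ T then
        (4 * ((2 : ℝ) ^ j) ^ 2) * (levelMean ρ z j ^ 2 + levelMean ρ z (j - 1) ^ 2) else 0 :=
      fun z => by
        have h0 : levelMean ρ z 0 ^ 2 ≤ K ^ 2 := sq_le_sq' (abs_le.1 (abs_levelMean_le hK hρ z 0)).1
          (abs_le.1 (abs_levelMean_le hK hρ z 0)).2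
        rw [levelEst_eq]
        split_ifs
        · set u := levelMean ρ z j
          set v := levelMean ρ z (j - 1)
          set w := levelMean ρ z 0
          set p := (2 : ℝ) ^ j
          -- Two parallelogram identities in one; the discarded terms are squares.
          have h1 : (w + p * (u - v)) ^ 2 + (w - p * (u - v)) ^ 2 + 2 * (p * (u + v)) ^ 2
              = 2 * w ^ 2 + 4 * p ^ 2 * (u ^ 2 + v ^ 2) := by ring
          linarith [sq_nonneg (w - p * (u - v)), sq_nonneg (p * (u + v))]
        · nlinarith [sq_nonneg K]
    refine (expect_mono (hb _ _) (hb _ _) fun z _ => hpt z).trans ?_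
    rw [expect_add (hb _ _) (hb _ _), expect_const]
    refine add_le_add le_rfl ?_
    split_ifs
    · rw [expect_const_mul, expect_add (hb _ _) (hb _ _)]
      have h1 := c.expect_levelMean_sq_le θ s hV (le_refl (2 ^ j))
      have h2 := c.expect_levelMean_sq_le θ s hV
        (Nat.pow_le_pow_right two_pos (Nat.sub_le j 1))
      obtain ⟨i, rfl⟩ := Nat.exists_eq_succ_of_ne_zero hj0
      simp only [Nat.succ_eq_add_one, Nat.add_sub_cancel] at *
      -- The constant 12 is 4(1 + 2): the coarser average has half as many samples, hence twice the
      -- variance bound.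
      calc _ ≤ (4 * ((2 : ℝ) ^ (i + 1)) ^ 2) *
            (((2 : ℝ) ^ (i + 1))⁻¹ * V + ((2 : ℝ) ^ i)⁻¹ * V) :=
            mul_le_mul_of_nonneg_left (add_le_add h1 h2) (by positivity)
        _ = _ := by field_simp; ring
    · rw [expect_const]
  have hbl : BddOn levelLaw fun j =>
      expect (c.trajectory θ (2 ^ j) s) fun z => levelEst T ρ z j ^ 2 :=
    ⟨(K + T * (2 * K)) ^ 2, fun j _ => abs_expect_le fun z _ => by
      rw [abs_pow]
      exact pow_le_pow_left₀ (abs_nonneg _) (abs_levelEst_le hK hρ T z j) 2⟩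
  refine (expect_mono hbl (bddOn_levelLaw_ite _ _ _) h).trans ?_
  rw [expect_levelLaw_ite _ _ hT]
  have h2 : ∀ i : ℕ, (1 / 2 : ℝ) ^ (i + 1) * (2 ^ (i + 1) * (12 * V)) = 12 * V := fun i => by
    rw [← mul_assoc, ← mul_pow]; norm_num
  simp only [h2, Finset.sum_const, Finset.card_range, nsmul_eq_mul]
  linarith

end Config

end MAC

namespace MAC

/-! ### The deterministic recursion -/

lemma rpow_add_one_sub_le {ν x : ℝ} (hν : 0 ≤ ν) (hν1 : ν ≤ 1) (hx : 0 < x) :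
    (x + 1) ^ ν - x ^ ν ≤ ν * x ^ (ν - 1) := by
  have h1 : (x + 1) ^ ν = x ^ ν * (1 + 1 / x) ^ ν := by
    rw [← Real.mul_rpow hx.le (by positivity)]
    congr 1
    field_simp
  have h2 : (1 + 1 / x) ^ ν ≤ 1 + ν * (1 / x) :=
    rpow_one_add_le_one_add_mul_self (by linarith [one_div_pos.2 hx]) hν hν1
  have h3 := mul_le_mul_of_nonneg_left h2 (Real.rpow_nonneg hx.le ν)
  rw [Real.rpow_sub_one hx.ne']
  calc _ ≤ x ^ ν * (1 + ν * (1 / x)) - x ^ ν := by rw [h1]; linarith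
    _ = _ := by ring

/-- The integral comparison for x^(-p), done by induction with Bernoulli's inequality at -1/y for
the increment of y^(1-p). -/
lemma sum_rpow_neg_le {p : ℝ} (hp : 0 < p) (hp1 : p < 1) (T : ℕ) :
    ∑ k ∈ Finset.range T, (1 + ((k + 1 : ℕ) : ℝ)) ^ (-p) ≤ (T : ℝ) ^ (1 - p) / (1 - p) := by
  induction T with
  | zero => simp [Real.zero_rpow (by linarith : 1 - p ≠ 0)]
  | succ T ih =>
    rw [Finset.sum_range_succ]
    set y : ℝ := ((T + 1 : ℕ) : ℝ) with hy
    have hy1 : y = T + 1 := by rw [hy]; push_cast; ring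
    have hT : (0 : ℝ) ≤ T := Nat.cast_nonneg T
    have hy0 : 0 < y := by linarith
    have h1p : 0 < 1 - p := by linarith
    have hle : (1 + y) ^ (-p) ≤ y ^ (-p) :=
      Real.rpow_le_rpow_of_nonpos hy0 (by linarith) (by linarith)
    have hkey : (T : ℝ) ^ (1 - p) ≤ y ^ (1 - p) - (1 - p) * y ^ (-p) := by
      have hT' : (T : ℝ) = y * (1 + (-(1 / y))) := by
        field_simp; linarith
      have hy1' : 1 / y ≤ 1 := by rw [div_le_one hy0]; linarith
      have h2 : (1 + (-(1 / y))) ^ (1 - p) ≤ 1 + (1 - p) * (-(1 / y)) :=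
        rpow_one_add_le_one_add_mul_self (by linarith) h1p.le (by linarith)
      have h3 := mul_le_mul_of_nonneg_left h2 (Real.rpow_nonneg hy0.le (1 - p))
      have h4 : y ^ (-p) = y ^ (1 - p) / y := by
        rw [← Real.rpow_sub_one hy0.ne']; congr 1; ring
      rw [hT', Real.mul_rpow hy0.le (by linarith), h4]
      calc _ ≤ _ := h3
        _ = _ := by ring
    have h5 : (T : ℝ) ^ (1 - p) / (1 - p) + y ^ (-p) ≤ y ^ (1 - p) / (1 - p) := by
      rw [div_add' _ _ _ h1p.ne', div_le_div_iff_of_pos_right h1p]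
      linarith
    linarith

/-- Summation by parts. -/
lemma sum_mul_sub_eq (H A : ℕ → ℝ) (T : ℕ) :
    ∑ k ∈ Finset.range T, H (k + 1) * (A k - A (k + 1)) + H T * A T
      = H 0 * A 0 + ∑ k ∈ Finset.range T, (H (k + 1) - H k) * A k := by
  induction T with
  | zero => simp
  | succ T ih =>
    rw [Finset.sum_range_succ, Finset.sum_range_succ]
    linarith

/-- The increments are of order k^(ν-1) and tend to 0. Once they are below 1/4, the
summation-by-parts term can be absorbed; `N` depends on ν only. -/
lemma exists_rpow_increment_le {ν : ℝ} (hν : 0 < ν) (hν1 : ν < 1) :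
    ∃ N : ℕ, ∀ k : ℕ, (1 + ((k + 1 : ℕ) : ℝ)) ^ ν - (1 + (k : ℝ)) ^ ν
      ≤ 1 / 4 + if k < N then 1 else 0 := by
  have hinc : ∀ k : ℕ, (1 + ((k + 1 : ℕ) : ℝ)) ^ ν - (1 + (k : ℝ)) ^ ν
      ≤ (1 + (k : ℝ)) ^ (ν - 1) := fun k => by
    have h := rpow_add_one_sub_le hν.le hν1.le (by positivity : (0 : ℝ) < 1 + k)
    have h0 : 0 ≤ (1 + (k : ℝ)) ^ (ν - 1) := by positivity
    rw [show (1 : ℝ) + ((k + 1 : ℕ) : ℝ) = 1 + k + 1 by push_cast; ring]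
    nlinarith
  have hlim : Tendsto (fun k : ℕ => (1 + (k : ℝ)) ^ (-(1 - ν))) atTop (𝓝 0) :=
    (tendsto_rpow_neg_atTop (by linarith)).comp
      (tendsto_atTop_add_const_left _ _ tendsto_natCast_atTop_atTop)
  obtain ⟨N, hN⟩ := eventually_atTop.1 (hlim.eventually_le_const (by norm_num : (0 : ℝ) < 1 / 4))
  refine ⟨N, fun k => (hinc k).trans ?_⟩
  split_ifs with hk
  · have : (1 + (k : ℝ)) ^ (ν - 1) ≤ 1 :=
      Real.rpow_le_one_of_one_le_of_nonpos (by linarith [(Nat.cast_nonneg k : (0 : ℝ) ≤ k)])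
        (by linarith)
    linarith
  · have := hN k (not_lt.1 hk)
    rw [neg_sub] at this
    linarith

/-- The average of a nonnegative sequence that contracts at the rate `(1 + t) ^ (-ν)` up to
perturbations. -/
lemma exists_average_le {ν σ : ℝ} (hν : 0 < ν) (hνσ : ν < σ) (hσ : σ < 1) :
    ∃ C : ℝ, 0 ≤ C ∧ ∀ (A γ α : ℕ → ℝ) (c₁ c₂ c₃ : ℝ) (T : ℕ), 1 ≤ T → (∀ k, 0 ≤ A k) →
      0 ≤ c₁ → 0 ≤ c₂ → 0 ≤ c₃ → (∀ k : ℕ, γ k = (1 + ((k + 1 : ℕ) : ℝ)) ^ (-ν)) →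
      (∀ k : ℕ, α k = (1 + ((k + 1 : ℕ) : ℝ)) ^ (-σ)) →
      (∀ k < T, A (k + 1) ≤ (1 - γ k / 2) * A k + c₁ * (α k ^ 2 / γ k) + c₂ * γ k ^ 2
        + c₃ * γ k) →
      (1 / (T : ℝ)) * ∑ k ∈ Finset.range T, A k ≤ C * ((A 0 + c₁) * (T : ℝ) ^ (ν - 1)
        + c₁ * (T : ℝ) ^ (-2 * (σ - ν)) + c₂ * (T : ℝ) ^ (-ν) + c₃) := by
  obtain ⟨N, hN⟩ := exists_rpow_increment_le hν (hνσ.trans hσ)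
  set p := 2 * (σ - ν) with hp
  -- The exponent 2(σ - ν) may reach or exceed 1, where the power sum changes its growth. Capping it
  -- at 1 - ν costs only a term T^(ν-1), already present in the bound.
  set p' := min p (1 - ν) with hp'
  have hp'0 : 0 < p' := lt_min (by linarith) (by linarith)
  have hp'1 : p' < 1 := (min_le_right _ _).trans_lt (by linarith)
  have h1p' : 0 < 1 - p' := by linarith
  have h1ν : 0 < 1 - ν := by linarith
  refine ⟨4 * (1 + N) + 4 * N ^ 2 + 4 / (1 - p') + 4 / (1 - ν) + 4, by positivity, ?_⟩
  intro A γ α c₁ c₂ c₃ T hT hA hc₁ hc₂ hc₃ hγ hα hrec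
  have hTr : (1 : ℝ) ≤ T := by exact_mod_cast hT
  have hT0 : (0 : ℝ) < T := by linarith
  have hbase : ∀ k : ℕ, (1 : ℝ) ≤ 1 + ((k + 1 : ℕ) : ℝ) := fun k => by
    linarith [(Nat.cast_nonneg (k + 1) : (0 : ℝ) ≤ ((k + 1 : ℕ) : ℝ))]
  have hγ0 : ∀ k, 0 < γ k := fun k => by
    rw [hγ]; exact Real.rpow_pos_of_pos (by linarith [hbase k]) _
  have hγ1 : ∀ k, γ k ≤ 1 := fun k => by
    rw [hγ]; exact Real.rpow_le_one_of_one_le_of_nonpos (hbase k) (by linarith)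
  set H : ℕ → ℝ := fun k => (1 + (k : ℝ)) ^ ν with hH
  have hHγ : ∀ k, H (k + 1) * γ k = 1 := fun k => by
    have : (0 : ℝ) < 1 + ((k + 1 : ℕ) : ℝ) := by linarith [hbase k]
    rw [hγ, hH, ← Real.rpow_add this]; simp
  have hH0 : ∀ k, 0 ≤ H k := fun k => by rw [hH]; positivity
  have hα1 : ∀ k, α k ^ 2 / γ k ≤ 1 := fun k => by
    rw [div_le_one (hγ0 k), hα, hγ, ← Real.rpow_natCast, ← Real.rpow_mul (by linarith [hbase k])]
    refine Real.rpow_le_rpow_of_exponent_le (hbase k) ?_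
    push_cast; linarith
  have hα2 : ∀ k, α k ^ 2 / γ k / γ k ≤ (1 + ((k + 1 : ℕ) : ℝ)) ^ (-p') := fun k => by
    have hb : (0 : ℝ) < 1 + ((k + 1 : ℕ) : ℝ) := by linarith [hbase k]
    rw [hα, hγ, ← Real.rpow_natCast, ← Real.rpow_mul hb.le, ← Real.rpow_sub hb,
      ← Real.rpow_sub hb]
    refine Real.rpow_le_rpow_of_exponent_le (hbase k) ?_
    have : p' ≤ p := min_le_left _ _
    push_cast; linarith
  -- a crude bound on the first terms
  have hcrude : ∀ k ≤ T, A k ≤ A 0 + k * (c₁ + c₂ + c₃) := fun k => by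
    induction k with
    | zero => simp
    | succ k ih =>
      intro hk
      have h1 := ih (by omega)
      have h2 := hrec k (by omega)
      have h3 := mul_le_mul_of_nonneg_left (hα1 k) hc₁
      have h4 : c₂ * γ k ^ 2 ≤ c₂ * 1 :=
        mul_le_mul_of_nonneg_left (pow_le_one₀ (hγ0 k).le (hγ1 k)) hc₂
      have h5 := mul_le_mul_of_nonneg_left (hγ1 k) hc₃
      have h6 := mul_nonneg (hγ0 k).le (hA k)
      push_cast
      linarith
  -- The fewer than `N + 1` early terms cannot be absorbed and are paid for by the crude linear
  -- bound.
  have hN' : ∑ k ∈ Finset.range T, (if k < N then (1 : ℝ) else 0) * A k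
      ≤ N * (A 0 + N * (c₁ + c₂ + c₃)) := by
    have hD : 0 ≤ c₁ + c₂ + c₃ := by positivity
    calc _ = ∑ k ∈ Finset.range T, if k < N then A k else 0 :=
          Finset.sum_congr rfl fun k _ => by split_ifs <;> simp
      _ = ∑ k ∈ (Finset.range T).filter (· < N), A k := (Finset.sum_filter _ _).symm
      _ ≤ ∑ _k ∈ (Finset.range T).filter (· < N), (A 0 + N * (c₁ + c₂ + c₃)) := by
          refine Finset.sum_le_sum fun k hk => ?_
          rw [Finset.mem_filter, Finset.mem_range] at hk
          have hkN : (k : ℝ) ≤ N := by exact_mod_cast hk.2.le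
          linarith [hcrude k hk.1.le, mul_le_mul_of_nonneg_right hkN hD]
      _ = ((Finset.range T).filter (· < N)).card * (A 0 + N * (c₁ + c₂ + c₃)) := by
          rw [Finset.sum_const, nsmul_eq_mul]
      _ ≤ _ := by
          refine mul_le_mul_of_nonneg_right ?_ (add_nonneg (hA 0) (by positivity))
          have : ((Finset.range T).filter (· < N)).card ≤ (Finset.range N).card :=
            Finset.card_le_card fun k hk => by
              rw [Finset.mem_filter] at hk; exact Finset.mem_range.2 hk.2
          rw [Finset.card_range] at this
          exact_mod_cast this
  -- The recursion divided by γ_k, that is, multiplied by `H (k + 1)`, and solved for `A k`.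
  have hpt : ∀ k ∈ Finset.range T, A k ≤ 2 * (H (k + 1) * (A k - A (k + 1)))
      + 2 * c₁ * (1 + ((k + 1 : ℕ) : ℝ)) ^ (-p') + 2 * c₂ * (1 + ((k + 1 : ℕ) : ℝ)) ^ (-ν)
      + 2 * c₃ := fun k hk => by
    have h := mul_le_mul_of_nonneg_left (hrec k (Finset.mem_range.1 hk)) (hH0 (k + 1))
    have hHe : H (k + 1) = 1 / γ k := by rw [eq_div_iff (hγ0 k).ne']; exact hHγ k
    have h2 := mul_le_mul_of_nonneg_left (hα2 k) hc₁
    rw [← hγ k]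
    have h3 : H (k + 1) * ((1 - γ k / 2) * A k + c₁ * (α k ^ 2 / γ k) + c₂ * γ k ^ 2
        + c₃ * γ k) = H (k + 1) * A k - A k / 2 + c₁ * (α k ^ 2 / γ k / γ k) + c₂ * γ k + c₃ := by
      have := (hγ0 k).ne'
      rw [hHe]; field_simp
    rw [h3] at h
    linarith
  have hsum := Finset.sum_le_sum hpt
  simp only [Finset.sum_add_distrib, ← Finset.mul_sum, Finset.sum_const, Finset.card_range,
    nsmul_eq_mul] at hsum
  have habel := sum_mul_sub_eq H A T
  have hHT := mul_nonneg (hH0 T) (hA T)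
  have hH00 : H 0 = 1 := by simp [hH]
  have hinc : ∑ k ∈ Finset.range T, (H (k + 1) - H k) * A k
      ≤ 1 / 4 * ∑ k ∈ Finset.range T, A k + N * (A 0 + N * (c₁ + c₂ + c₃)) := by
    refine le_trans (Finset.sum_le_sum fun k _ =>
      mul_le_mul_of_nonneg_right (hN k) (hA k)) ?_
    simp only [add_mul, Finset.sum_add_distrib, ← Finset.mul_sum]
    linarith
  have hs1 := mul_le_mul_of_nonneg_left (sum_rpow_neg_le hp'0 hp'1 T) hc₁
  have hs2 := mul_le_mul_of_nonneg_left (sum_rpow_neg_le hν (by linarith) T) hc₂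
  set Z := ∑ k ∈ Finset.range T, A k with hZ
  -- The increments of `H` contribute 2 · Z/4 on the right; moving this half to the left doubles the
  -- other constants from 2 to 4.
  have hmain : Z ≤ 4 * (1 + N) * A 0 + 4 * N ^ 2 * (c₁ + c₂ + c₃)
      + 4 * (c₁ * ((T : ℝ) ^ (1 - p') / (1 - p'))) + 4 * (c₂ * ((T : ℝ) ^ (1 - ν) / (1 - ν)))
      + 4 * (c₃ * T) := by
    rw [hH00, one_mul] at habel
    linarith
  -- powers of `T`
  set a := (T : ℝ) ^ (ν - 1) with ha
  set b := (T : ℝ) ^ (-2 * (σ - ν)) with hb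
  set d := (T : ℝ) ^ (-ν) with hd
  have ha0 : 0 < a := Real.rpow_pos_of_pos hT0 _
  have hb0 : 0 < b := Real.rpow_pos_of_pos hT0 _
  have hd0 : 0 < d := Real.rpow_pos_of_pos hT0 _
  have hTinv : ∀ e : ℝ, -1 ≤ e → 1 / (T : ℝ) ≤ (T : ℝ) ^ e := fun e he => by
    rw [one_div, ← Real.rpow_neg_one]
    exact Real.rpow_le_rpow_of_exponent_le hTr he
  have hTa : 1 / (T : ℝ) ≤ a := hTinv _ (by linarith)
  have hTd : 1 / (T : ℝ) ≤ d := hTinv _ (by linarith)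
  have hT1 : 1 / (T : ℝ) ≤ 1 := by rw [div_le_one hT0]; exact hTr
  have hpow : ∀ e : ℝ, 1 / (T : ℝ) * (T : ℝ) ^ (1 - e) = (T : ℝ) ^ (-e) := fun e => by
    rw [one_div, ← Real.rpow_neg_one, ← Real.rpow_add hT0]; congr 1; ring
  have hmin : (T : ℝ) ^ (-p') ≤ a + b := by
    rcases min_choice p (1 - ν) with h | h
    · rw [hp', h, hp, hb, neg_mul]; linarith
    · rw [hp', h, neg_sub]; linarith
  have hi : (0 : ℝ) ≤ 1 / T := by positivity
  calc 1 / (T : ℝ) * Z ≤ 1 / (T : ℝ) * (4 * (1 + N) * A 0 + 4 * N ^ 2 * (c₁ + c₂ + c₃)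
      + 4 * (c₁ * ((T : ℝ) ^ (1 - p') / (1 - p'))) + 4 * (c₂ * ((T : ℝ) ^ (1 - ν) / (1 - ν)))
      + 4 * (c₃ * T)) := mul_le_mul_of_nonneg_left hmain hi
    _ = 4 * (1 + N) * A 0 * (1 / T) + 4 * N ^ 2 * c₁ * (1 / T) + 4 * N ^ 2 * c₂ * (1 / T)
        + 4 * N ^ 2 * c₃ * (1 / T) + 4 / (1 - p') * c₁ * (1 / T * (T : ℝ) ^ (1 - p'))
        + 4 / (1 - ν) * c₂ * (1 / T * (T : ℝ) ^ (1 - ν)) + 4 * c₃ := by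
        field_simp; ring
    _ ≤ 4 * (1 + N) * A 0 * a + 4 * N ^ 2 * c₁ * a + 4 * N ^ 2 * c₂ * d
        + 4 * N ^ 2 * c₃ * 1 + 4 / (1 - p') * c₁ * (a + b)
        + 4 / (1 - ν) * c₂ * d + 4 * c₃ := by
        rw [hpow, hpow, ← hd]
        have := hA 0
        gcongr
    _ ≤ _ := by
        have hA0 := hA 0
        have e1 : 0 ≤ 4 / (1 - p') := by positivity
        have e2 : 0 ≤ 4 / (1 - ν) := by positivity
        have e3 : (0 : ℝ) ≤ 4 * (1 + N) := by positivity
        have e4 : (0 : ℝ) ≤ 4 * N ^ 2 := by positivity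
        set u₁ := 4 / (1 - p')
        set u₂ := 4 / (1 - ν)
        set u₃ : ℝ := 4 * (1 + N)
        set u₄ : ℝ := 4 * N ^ 2
        rw [← sub_nonneg]
        have : (u₃ + u₄ + u₁ + u₂ + 4) * ((A 0 + c₁) * a + c₁ * b + c₂ * d + c₃)
          - (u₃ * A 0 * a + u₄ * c₁ * a + u₄ * c₂ * d + u₄ * c₃ * 1 + u₁ * c₁ * (a + b)
            + u₂ * c₂ * d + 4 * c₃)
          = (u₄ + u₁ + u₂ + 4) * (A 0 * a) + (u₃ + u₂ + 4) * (c₁ * a)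
            + (u₃ + u₄ + u₂ + 4) * (c₁ * b) + (u₃ + u₁ + 4) * (c₂ * d)
            + (u₃ + u₁ + u₂) * c₃ := by ring
        rw [this]
        positivity

end MAC

namespace MAC

/-! ### One iteration of the algorithm -/

section Expect

variable {X Y : Type*} {p : PMF X} {q : X → PMF Y} {F : Y → ℝ} {G : X → ℝ}

lemma BddOn.of_bind (hF : BddOn (p.bind q) F) {x : X} (hx : x ∈ p.support) : BddOn (q x) F := by
  obtain ⟨K, hK⟩ := hF
  exact ⟨K, fun y hy => hK y ((PMF.mem_support_bind_iff _ _ _).2 ⟨x, hx, hy⟩)⟩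

lemma BddOn.expect_of_bind (hF : BddOn (p.bind q) F) : BddOn p fun x => expect (q x) F := by
  obtain ⟨K, hK⟩ := hF
  exact ⟨K, fun x hx => abs_expect_le fun y hy =>
    hK y ((PMF.mem_support_bind_iff _ _ _).2 ⟨x, hx, hy⟩)⟩

lemma expect_bind_le (hF : BddOn (p.bind q) F) (hG : BddOn p G)
    (h : ∀ x ∈ p.support, expect (q x) F ≤ G x) : expect (p.bind q) F ≤ expect p G := by
  rw [expect_bind hF]
  exact expect_mono hF.expect_of_bind hG h

end Expect

namespace Config

variable {S A : Type*} {q m : ℕ} (c : Config S A q m)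

lemma exists_of_mem_support_step {t : ℕ} {x y : AlgState S q m} (hy : y ∈ (c.step t x).support) :
    ∃ j z s', z.length = 2 ^ j ∧ y = c.update t x j z s' := by
  simp only [step, PMF.mem_support_bind_iff, PMF.mem_support_map_iff] at hy
  obtain ⟨j, -, z, hz, s', -, rfl⟩ := hy
  exact ⟨j, z, s', c.length_of_mem_trajectory hz, rfl⟩

/-- An actor step has length at most `α'`. -/
lemma norm_update_θ_sub_le {t : ℕ} {x : AlgState S q m} (hx : 0 ≤ x.sumSq)
    (hα : 0 ≤ c.α' t) (j : ℕ) (z : List (Sample S A)) (s' : S) :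
    ‖(c.update t x j z s').θ - x.θ‖ ≤ c.α' t := by
  simp only [update, add_sub_cancel_left, norm_smul]
  set h := mlmc c.Tmax (c.hSample x) z j
  -- The accumulator already contains the current ‖h‖². If it is 0, division by zero gives a zero
  -- step and the bound persists.
  have hle : ‖h‖ ≤ √(x.sumSq + ‖h‖ ^ 2) := Real.le_sqrt_of_sq_le (by linarith)
  rw [Real.norm_of_nonneg (by positivity), div_mul_eq_mul_div, mul_div_assoc]
  exact mul_le_of_le_one_right hα (div_le_one_of_le₀ hle (Real.sqrt_nonneg _))

/-- The centre `b` is free: b = J(θ) gives the error recursion, b = 0 the boundedness of the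
tracker. -/
lemma update_η {t : ℕ} (x : AlgState S q m) {j : ℕ} {z : List (Sample S A)}
    (hz : z.length = 2 ^ j) (s' : S) (b : ℝ) :
    (c.update t x j z s').η
      = x.η - c.γ t * ((x.η - b) - levelEst c.Tmax (fun s a => c.mdp.r s a - b) z j) := by
  have h : c.fSample x = fun y => (x.η - b) - (c.mdp.r y.1 y.2.1 - b) := by
    funext y
    simp [fSample]
  simp only [update]
  rw [h, mlmc_const_sub _ _ hz]
  rfl

-- The new tracker is a convex combination of the old one and the estimator. This bound grows with
-- `Tmax` and serves integrability only.
variable {c} in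
lemma abs_η_le_of_mem_step {rmax : ℝ} (hr0 : 0 ≤ rmax)
    (hr : ∀ s a, 0 ≤ c.mdp.r s a ∧ c.mdp.r s a ≤ rmax) {t : ℕ} (hγ0 : 0 ≤ c.γ t)
    (hγ1 : c.γ t ≤ 1) {x y : AlgState S q m} (hy : y ∈ (c.step t x).support) {H : ℝ}
    (hx : |x.η| ≤ H) (hH : rmax + c.Tmax * (2 * rmax) ≤ H) : |y.η| ≤ H := by
  obtain ⟨j, z, s', hz, rfl⟩ := c.exists_of_mem_support_step hy
  rw [c.update_η x hz s' 0]
  have hX := (abs_levelEst_le hr0 (ρ := fun s a => c.mdp.r s a - 0) (fun s a => by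
    rw [sub_zero, abs_of_nonneg (hr s a).1]; exact (hr s a).2) c.Tmax z j).trans hH
  set X := levelEst c.Tmax (fun s a => c.mdp.r s a - 0) z j
  have h : x.η - c.γ t * (x.η - 0 - X) = (1 - c.γ t) * x.η + c.γ t * X := by ring
  rw [h]
  calc _ ≤ |(1 - c.γ t) * x.η| + |c.γ t * X| := abs_add_le _ _
    _ = (1 - c.γ t) * |x.η| + c.γ t * |X| := by
        rw [abs_mul, abs_mul, abs_of_nonneg hγ0, abs_of_nonneg (by linarith : 0 ≤ 1 - c.γ t)]
    _ ≤ (1 - c.γ t) * H + c.γ t * H := by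
        have : 0 ≤ 1 - c.γ t := by linarith
        gcongr
    _ = H := by ring

lemma sumSq_nonneg_of_mem_step {t : ℕ} {x y : AlgState S q m} (hy : y ∈ (c.step t x).support)
    (hx : 0 ≤ x.sumSq) : 0 ≤ y.sumSq := by
  obtain ⟨j, z, s', -, rfl⟩ := c.exists_of_mem_support_step hy
  simp only [update]
  positivity

lemma law_succ {t : ℕ} (ht : 1 ≤ t) : c.law (t + 1) = (c.law t).bind (c.step t) := by
  obtain ⟨k, rfl⟩ : ∃ k, t = k + 1 := ⟨t - 1, by omega⟩
  rw [law]

variable {c} in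
/-- The tracker is bounded at every iteration and the AdaGrad accumulator is nonnegative. -/
lemma law_invariant {rmax : ℝ} (hr0 : 0 ≤ rmax)
    (hr : ∀ s a, 0 ≤ c.mdp.r s a ∧ c.mdp.r s a ≤ rmax) (hγ0 : ∀ t, 0 ≤ c.γ t)
    (hγ1 : ∀ t, c.γ t ≤ 1) {t : ℕ} (ht : 1 ≤ t) :
    ∀ x ∈ (c.law t).support,
      |x.η| ≤ max |c.η₁| (rmax + c.Tmax * (2 * rmax)) ∧ 0 ≤ x.sumSq := by
  induction t, ht using Nat.le_induction with
  | base =>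
    intro x hx
    simp only [law, init, PMF.mem_support_map_iff] at hx
    obtain ⟨s, -, rfl⟩ := hx
    exact ⟨le_max_left _ _, le_rfl⟩
  | succ t ht ih =>
    intro y hy
    rw [c.law_succ ht, PMF.mem_support_bind_iff] at hy
    obtain ⟨x, hx, hy⟩ := hy
    obtain ⟨h1, h2⟩ := ih x hx
    exact ⟨abs_η_le_of_mem_step hr0 hr (hγ0 t) (hγ1 t) hy h1 (le_max_right _ _),
      c.sumSq_nonneg_of_mem_step hy h2⟩

/-! ### Bias, second moment and drift of the squared error. -/

variable [Fintype S] [Fintype A] [Nonempty S] {c}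

lemma abs_sqError_le {rmax : ℝ}
    (hr : ∀ s a, 0 ≤ c.mdp.r s a ∧ c.mdp.r s a ≤ rmax)
    (herg : ∀ θ, c.mdp.Ergodic (c.policy θ)) {x : AlgState S q m} {H : ℝ} (hx : |x.η| ≤ H) :
    |c.sqError x| ≤ (H + rmax) ^ 2 := by
  classical
  obtain ⟨h0, h1⟩ := MDP.avgReward_mem (herg x.θ) hr
  rw [sqError, abs_pow]
  refine pow_le_pow_left₀ (abs_nonneg _) ((abs_sub _ _).trans (add_le_add hx ?_)) 2
  rw [abs_of_nonneg]
  exacts [h1, h0]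

/-- The means of the accumulated centred rewards are bounded by the mixing time. -/
lemma abs_expect_total_le {rmax : ℝ}
    (hr : ∀ s a, 0 ≤ c.mdp.r s a ∧ c.mdp.r s a ≤ rmax)
    (herg : ∀ θ, c.mdp.Ergodic (c.policy θ)) (θ : Vec q) (N : ℕ) (s : S) :
    |expect (c.trajectory θ N s) (total fun s a => c.mdp.r s a - c.J θ)|
      ≤ 2 * c.tauMix θ * rmax := by
  classical
  have h := herg θ
  have hf : (fun s => ∑ a, (c.policy θ s a).toReal * (c.mdp.r s a - c.J θ))
      = fun s => c.mdp.meanReward (c.policy θ) s - c.J θ := funext fun s => by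
    simp only [mul_sub, Finset.sum_sub_distrib, ← Finset.sum_mul, sum_toReal, one_mul]
    rfl
  have hosc : OscLE (fun s => c.mdp.meanReward (c.policy θ) s - c.J θ) rmax := fun s s' => by
    have h1 := (MDP.meanReward_mem (p := c.policy θ) hr s).2
    have h2 := (MDP.meanReward_mem (p := c.policy θ) hr s').1
    linarith
  have hmean : ∑ y, c.mdp.stationary (c.policy θ) y *
      (c.mdp.meanReward (c.policy θ) y - c.J θ) = 0 := by
    simp only [mul_sub, Finset.sum_sub_distrib, ← Finset.sum_mul,
      (MDP.isStationary_stationary h).sum_one, one_mul]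
    rw [← MDP.avgReward_eq h]
    exact sub_self _
  have := MDP.sum_abs_sub_stationary_le h hosc s N
  rw [hmean] at this
  simp only [sub_zero] at this
  rw [expect_total, hf]
  exact (Finset.abs_sum_le_sum_abs _ _).trans this

/-- The factor 3/2 exceeds 1 / log 2. -/
lemma one_le_mul_log {T : ℕ} (hT : 2 ≤ T) : 1 ≤ 3 / 2 * Real.log T := by
  have h1 : Real.log 2 ≤ Real.log T :=
    Real.log_le_log (by norm_num) (by exact_mod_cast hT)
  linarith [Real.log_two_gt_d9]

lemma natLog_le_log {T : ℕ} (hT : 2 ≤ T) : (Nat.log 2 T : ℝ) ≤ 3 / 2 * Real.log T := by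
  have h1 : (2 : ℝ) ^ Nat.log 2 T ≤ T := by exact_mod_cast Nat.pow_log_le_self 2 (by omega)
  have h2 := Real.log_le_log (by positivity) h1
  rw [Real.log_pow] at h2
  have h3 : (0 : ℝ) ≤ Nat.log 2 T := Nat.cast_nonneg _
  nlinarith [Real.log_two_gt_d9]

/-- Bias and second moment of the multi-level estimator of the average reward. -/
lemma levelEst_moments {rmax : ℝ} (hr0 : 0 ≤ rmax)
    (hr : ∀ s a, 0 ≤ c.mdp.r s a ∧ c.mdp.r s a ≤ rmax)
    (herg : ∀ θ, c.mdp.Ergodic (c.policy θ)) (hT : 2 ≤ c.Tmax) (θ : Vec q) {τ : ℕ}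
    (hτ : c.tauMix θ ≤ τ) (s : S) :
    expect levelLaw (fun j => expect (c.trajectory θ (2 ^ j) s) fun z =>
        levelEst c.Tmax (fun s a => c.mdp.r s a - c.J θ) z j) ^ 2
      ≤ 6 * rmax ^ 2 * (τ * Real.log c.Tmax / c.Tmax) ∧
    expect levelLaw (fun j => expect (c.trajectory θ (2 ^ j) s) fun z =>
        levelEst c.Tmax (fun s a => c.mdp.r s a - c.J θ) z j ^ 2)
      ≤ 93 * rmax ^ 2 * (τ * Real.log c.Tmax) := by
  classical
  have hT0 : c.Tmax ≠ 0 := by omega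
  have hTr : (0 : ℝ) < c.Tmax := by exact_mod_cast (by omega : 0 < c.Tmax)
  have hτ1 : (1 : ℝ) ≤ τ := by
    exact_mod_cast (MDP.mixingTime_spec (herg θ)).1.trans hτ
  obtain ⟨hJ0, hJ1⟩ := MDP.avgReward_mem (herg θ) hr
  set ρ : S → A → ℝ := fun s a => c.mdp.r s a - c.J θ with hρdef
  have hρ : ∀ s a, |ρ s a| ≤ rmax := fun s a => by
    have h1 := hr s a
    change 0 ≤ c.J θ at hJ0
    change c.J θ ≤ rmax at hJ1
    rw [hρdef, abs_le]
    constructor <;> dsimp only <;> linarith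
  have hD : ∀ N s, |expect (c.trajectory θ N s) (total ρ)| ≤ 2 * τ * rmax := fun N s =>
    (abs_expect_total_le hr herg θ N s).trans (by gcongr)
  have hlog := one_le_mul_log hT
  have hL := natLog_le_log hT
  constructor
  · rw [c.expect_levelEst θ ρ hT0]
    set M := expect (c.trajectory θ (2 ^ Nat.log 2 c.Tmax) s) (total ρ)
    set P := (2 : ℝ) ^ Nat.log 2 c.Tmax with hP
    have hP0 : 0 < P := by positivity
    have hPT : (c.Tmax : ℝ) ≤ 2 * P := by
      have := (Nat.lt_pow_succ_log_self one_lt_two c.Tmax).le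
      rw [pow_succ] at this
      have h : (c.Tmax : ℝ) ≤ 2 ^ Nat.log 2 c.Tmax * 2 := by exact_mod_cast this
      linarith
    have hM1 : |M| ≤ P * rmax := abs_expect_le fun z hz => by
      have := abs_total_le hρ z
      rw [c.length_of_mem_trajectory hz] at this
      push_cast at this
      exact this
    have hM2 : |M| ≤ 2 * τ * rmax := hD _ _
    -- One factor uses the trivial bound, the other the mixing bound, so the squared bias is linear
    -- in τ and of order 1/P.
    have hsq : M ^ 2 ≤ (P * rmax) * (2 * τ * rmax) := by
      rw [← sq_abs, sq]
      exact mul_le_mul hM1 hM2 (abs_nonneg _) (by positivity)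
    calc (P⁻¹ * M) ^ 2 = P⁻¹ ^ 2 * M ^ 2 := by ring
      _ ≤ P⁻¹ ^ 2 * ((P * rmax) * (2 * τ * rmax)) := by gcongr
      _ = 2 * τ * rmax ^ 2 * P⁻¹ := by field_simp
      _ ≤ 2 * τ * rmax ^ 2 * (2 / c.Tmax) := by
          gcongr
          rw [inv_le_comm₀ hP0 (by positivity), inv_div]
          linarith
      _ = 4 * τ * rmax ^ 2 / c.Tmax * 1 := by ring
      _ ≤ 4 * τ * rmax ^ 2 / c.Tmax * (3 / 2 * Real.log c.Tmax) := by gcongr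
      _ = _ := by ring
  · have hV := fun N => c.expect_total_sq_le θ hρ hD N s
    refine (c.expect_levelEst_sq_le θ hr0 hρ s hV hT0).trans ?_
    have hL1 : (1 : ℝ) ≤ Nat.log 2 c.Tmax := by
      exact_mod_cast Nat.log_pos one_lt_two hT
    set L : ℝ := (Nat.log 2 c.Tmax : ℝ)
    have h1 : 1 ≤ τ * L := by nlinarith
    have h2 : L ≤ τ * L := by nlinarith
    have hK : 0 ≤ rmax ^ 2 := sq_nonneg _
    -- As 1 ≤ τL and L ≤ τL, everything is absorbed into τL: 62 = 2 + 12 + 48 and 93 = 62 · 3/2.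
    calc 2 * rmax ^ 2 + 12 * (rmax ^ 2 + 2 * rmax * (2 * τ * rmax)) * L
        = rmax ^ 2 * (2 + 12 * L + 48 * (τ * L)) := by ring
      _ ≤ rmax ^ 2 * (62 * (τ * L)) := by gcongr; linarith
      _ ≤ rmax ^ 2 * (62 * (τ * (3 / 2 * Real.log c.Tmax))) := by gcongr
      _ = _ := by ring

/-- The expected change of the squared tracking error in one iteration. -/
lemma expect_step_sqError_le {rmax B : ℝ} (hr0 : 0 ≤ rmax) (hB0 : 0 ≤ B) (hB : c.BoundedScore B)
    (hr : ∀ s a, 0 ≤ c.mdp.r s a ∧ c.mdp.r s a ≤ rmax)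
    (herg : ∀ θ, c.mdp.Ergodic (c.policy θ)) (hT : 2 ≤ c.Tmax) {τ t : ℕ} (hγ0 : 0 < c.γ t)
    (hγ1 : c.γ t ≤ 1) (hα : 0 ≤ c.α' t) {x : AlgState S q m} (hx : 0 ≤ x.sumSq)
    (hτ : c.tauMix x.θ ≤ τ) :
    expect (c.step t x) c.sqError ≤ (1 - c.γ t / 2) * c.sqError x
      + 6 * ((2 * Fintype.card S + 1) * B * rmax) ^ 2 * (c.α' t ^ 2 / c.γ t)
      + 186 * rmax ^ 2 * (τ * Real.log c.Tmax) * c.γ t ^ 2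
      + 24 * rmax ^ 2 * (τ * Real.log c.Tmax / c.Tmax) * c.γ t := by
  classical
  obtain ⟨hbias, hvar⟩ := levelEst_moments hr0 hr herg hT x.θ hτ x.s
  obtain ⟨hJ0, hJ1⟩ := MDP.avgReward_mem (herg x.θ) hr
  set ρ : S → A → ℝ := fun s a => c.mdp.r s a - c.J x.θ with hρdef
  have hρ : ∀ s a, |ρ s a| ≤ rmax := fun s a => by
    have h1 := hr s a
    change 0 ≤ c.J x.θ at hJ0
    change c.J x.θ ≤ rmax at hJ1
    rw [hρdef, abs_le]
    constructor <;> dsimp only <;> linarith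
  set g := c.γ t
  set α := c.α' t
  set L := (2 * (Fintype.card S : ℝ) + 1) * B * rmax with hLdef
  have hL0 : 0 ≤ L := by positivity
  set e := x.η - c.J x.θ with he
  have hsx : c.sqError x = e ^ 2 := rfl
  set X : List (Sample S A) → ℕ → ℝ := fun z j => levelEst c.Tmax ρ z j with hX
  set b := expect levelLaw fun j => expect (c.trajectory x.θ (2 ^ j) x.s) fun z => X z j with hb
  set v := expect levelLaw fun j => expect (c.trajectory x.θ (2 ^ j) x.s) fun z => X z j ^ 2
    with hv
  -- The part not depending on the sample. Of the contraction g, one quarter pays for the drift here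
  -- and another for the bias in `hcross`, leaving g/2. The 6 is 4 from Young's inequality plus 2
  -- from 2Δ².
  set K := (1 - g) * e ^ 2 + g / 4 * e ^ 2 + 6 * L ^ 2 * (α ^ 2 / g) with hK
  have hpt : ∀ (j : ℕ) (z : List (Sample S A)) (s' : S), z.length = 2 ^ j →
      c.sqError (c.update t x j z s')
        ≤ K + 2 * (1 - g) * g * e * X z j + 2 * g ^ 2 * X z j ^ 2 := fun j z s' hz => by
    have hΔ := (abs_J_sub_le hB0 hB hr herg x.θ (c.update t x j z s').θ).trans
      (mul_le_mul_of_nonneg_left (c.norm_update_θ_sub_le hx hα j z s') hL0)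
    rw [sqError, c.update_η x hz s' (c.J x.θ)]
    change (x.η - g * (e - X z j) - _) ^ 2 ≤ _
    set Δ := c.J (c.update t x j z s').θ - c.J x.θ with hΔdef
    have h1 : x.η - g * (e - X z j) - c.J (c.update t x j z s').θ
        = (1 - g) * e + g * X z j - Δ := by rw [hΔdef, he]; ring
    rw [h1]
    set y := X z j
    have h2 : Δ ^ 2 ≤ L ^ 2 * α ^ 2 := by
      rw [← mul_pow, ← sq_abs]
      exact pow_le_pow_left₀ (abs_nonneg _) hΔ 2
    have h3 : Δ ^ 2 ≤ Δ ^ 2 / g := by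
      rw [le_div_iff₀ hγ0]
      nlinarith [sq_nonneg Δ]
    have h4 : Δ ^ 2 / g ≤ L ^ 2 * (α ^ 2 / g) := by
      rw [← mul_div_assoc]
      gcongr
    have h5 : -(2 * (1 - g) * e * Δ) ≤ g / 4 * e ^ 2 + 4 * (Δ ^ 2 / g) := by
      have h6 : 0 ≤ (g * e / 2 + 2 * (1 - g) * Δ) ^ 2 / g := by positivity
      have h7 : (g * e / 2 + 2 * (1 - g) * Δ) ^ 2 / g
          = g / 4 * e ^ 2 + 2 * (1 - g) * e * Δ + (1 - g) ^ 2 * (4 * (Δ ^ 2 / g)) := by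
        field_simp; ring
      have h8 : (1 - g) ^ 2 * (4 * (Δ ^ 2 / g)) ≤ 1 * (4 * (Δ ^ 2 / g)) :=
        mul_le_mul_of_nonneg_right (pow_le_one₀ (by linarith) (by linarith)) (by positivity)
      linarith
    have h9 : (1 - g) ^ 2 * e ^ 2 ≤ (1 - g) * e ^ 2 :=
      mul_le_mul_of_nonneg_right (by nlinarith) (sq_nonneg e)
    have h10 := sq_nonneg (g * y + Δ)
    calc ((1 - g) * e + g * y - Δ) ^ 2
        = (1 - g) ^ 2 * e ^ 2 + 2 * (1 - g) * g * e * y - 2 * (1 - g) * e * Δ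
          + 2 * g ^ 2 * y ^ 2 + 2 * Δ ^ 2 - (g * y + Δ) ^ 2 := by ring
      _ ≤ _ := by rw [hK]; linarith
  have hbdd : BddOn (c.step t x) c.sqError := by
    refine ⟨(max |x.η| (rmax + c.Tmax * (2 * rmax)) + rmax) ^ 2, fun y hy => ?_⟩
    exact abs_sqError_le hr herg
      (abs_η_le_of_mem_step hr0 hr hγ0.le hγ1 hy (le_max_left _ _) (le_max_right _ _))
  have hbt := fun j => c.bddOn_trajectory x.θ (2 ^ j) x.s
  have hb1 : BddOn levelLaw fun j =>
      expect (c.trajectory x.θ (2 ^ j) x.s) fun z => X z j :=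
    ⟨rmax + c.Tmax * (2 * rmax), fun j _ => abs_expect_le fun z _ =>
      abs_levelEst_le hr0 hρ c.Tmax z j⟩
  have hb2 : BddOn levelLaw fun j =>
      expect (c.trajectory x.θ (2 ^ j) x.s) fun z => X z j ^ 2 :=
    ⟨(rmax + c.Tmax * (2 * rmax)) ^ 2, fun j _ => abs_expect_le fun z _ => by
      rw [abs_pow]
      exact pow_le_pow_left₀ (abs_nonneg _) (abs_levelEst_le hr0 hρ c.Tmax z j) 2⟩
  have hstep : expect (c.step t x) c.sqError
      ≤ K + 2 * (1 - g) * g * e * b + 2 * g ^ 2 * v := by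
    have hle : expect (c.step t x) c.sqError ≤ expect levelLaw fun j =>
        (K + 2 * (1 - g) * g * e * expect (c.trajectory x.θ (2 ^ j) x.s) fun z => X z j)
          + 2 * g ^ 2 * expect (c.trajectory x.θ (2 ^ j) x.s) fun z => X z j ^ 2 := by
      refine expect_bind_le hbdd (((BddOn.const _ K).add (hb1.const_mul _)).add
        (hb2.const_mul _)) fun j hj => ?_
      have hbj := BddOn.of_bind (q := fun j => (c.trajectory x.θ (2 ^ j) x.s).bind fun z =>
        (c.restart (lastState x.s z)).map fun s' => c.update t x j z s') hbdd hj
      refine (expect_bind_le (G := fun z => K + 2 * (1 - g) * g * e * X z j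
        + 2 * g ^ 2 * X z j ^ 2) hbj (hbt j _) fun z hz => ?_).trans (le_of_eq ?_)
      · have hz' := c.length_of_mem_trajectory hz
        have hbz := hbj.of_bind hz
        refine (expect_mono hbz (BddOn.const _ _) fun y hy => ?_).trans
          (le_of_eq (expect_const _ (K + 2 * (1 - g) * g * e * X z j + 2 * g ^ 2 * X z j ^ 2)))
        obtain ⟨s', -, rfl⟩ := (PMF.mem_support_map_iff _ _ _).1 hy
        exact hpt j z s' hz'
      · rw [expect_add (hbt j _) (hbt j _), expect_add (hbt j _) (hbt j _), expect_const,
          expect_const_mul, expect_const_mul]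
    rwa [expect_add ((BddOn.const _ K).add (hb1.const_mul _)) (hb2.const_mul _),
      expect_add (BddOn.const _ K) (hb1.const_mul _), expect_const, expect_const_mul,
      expect_const_mul] at hle
  -- The error `e` is fixed before sampling, so the cross term sees the estimator only through its
  -- bias `b`.
  have hcross : 2 * (1 - g) * g * e * b ≤ g / 4 * e ^ 2 + 4 * g * b ^ 2 := by
    have h1 : 0 ≤ g * (e / 2 - 2 * (1 - g) * b) ^ 2 := by positivity
    have h2 : (1 - g) ^ 2 * (4 * g * b ^ 2) ≤ 1 * (4 * g * b ^ 2) :=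
      mul_le_mul_of_nonneg_right (pow_le_one₀ (by linarith) (by linarith)) (by positivity)
    linarith
  have h1 := mul_le_mul_of_nonneg_left hbias (by positivity : 0 ≤ 4 * g)
  have h2 := mul_le_mul_of_nonneg_left hvar (by positivity : 0 ≤ 2 * g ^ 2)
  rw [hsx]
  linarith

end Config

end MAC

/-! ### Assembly of the bound. -/

theorem mainTheorem4 (ν σ rmax B η₁ : ℝ) (n : ℕ) (hν : 0 < ν) (hνσ : ν < σ) (hσ : σ < 1) :
    ∃ C : ℝ, ∀ (S A : Type*) [Fintype S] [Fintype A] (q m : ℕ) (c : MAC.Config S A q m),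
      Fintype.card S = n →
      (∀ s a, 0 ≤ c.mdp.r s a ∧ c.mdp.r s a ≤ rmax) →
      (∀ θ, c.mdp.Ergodic (c.policy θ)) →
      c.BoundedScore B →
      (∀ t : ℕ, c.γ t = (1 + (t : ℝ)) ^ (-ν)) →
      (∀ t : ℕ, c.α' t = (1 + (t : ℝ)) ^ (-σ)) →
      c.η₁ = η₁ →
      2 ≤ c.Tmax →
      ∀ T τ : ℕ, 1 ≤ T →
        (∀ t ∈ Finset.Icc 1 T, ∀ x ∈ (c.law t).support, c.tauMix x.θ ≤ τ) →
        (∀ t ∈ Finset.Icc 1 T, Summable fun x => ((c.law t) x).toReal * c.sqError x) ∧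
        (1 / (T : ℝ)) * ∑ t ∈ Finset.Icc 1 T, MAC.expect (c.law t) c.sqError ≤
          C * ((T : ℝ) ^ (ν - 1) + (T : ℝ) ^ (-2 * (σ - ν))
            + τ * Real.log c.Tmax * (T : ℝ) ^ (-ν)
            + τ * Real.log c.Tmax / c.Tmax) := by
  obtain ⟨C, hC, hmain⟩ := MAC.exists_average_le hν hνσ hσ
  -- The summands cover the initial error, the actor drift, and the noise and bias together: 210 ≥
  -- 186 and 210 ≥ 24.
  refine ⟨C * ((|η₁| + rmax) ^ 2 + 6 * ((2 * n + 1) * B * rmax) ^ 2 + 210 * rmax ^ 2), ?_⟩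
  intro S A _ _ q m c hn hr herg hB hγ hα hη hT T τ hT1 hτ
  -- Probability laws have nonempty support; the resulting state and action give `0 ≤ rmax` and `0 ≤
  -- B`.
  obtain ⟨s₀, -⟩ := c.mdp.μ₀.support_nonempty
  obtain ⟨a₀, -⟩ := (c.policy c.θ₁ s₀).support_nonempty
  have : Nonempty S := ⟨s₀⟩
  have hr0 : 0 ≤ rmax := (hr s₀ a₀).1.trans (hr s₀ a₀).2
  have hB0 : 0 ≤ B := (norm_nonneg _).trans ((hB s₀ a₀).2.2 c.θ₁)
  have hbase : ∀ t : ℕ, (1 : ℝ) ≤ 1 + t := fun t => by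
    linarith [(Nat.cast_nonneg t : (0 : ℝ) ≤ t)]
  have hγ0 : ∀ t, 0 < c.γ t := fun t => by
    rw [hγ]; exact Real.rpow_pos_of_pos (by linarith [hbase t]) _
  have hγ1 : ∀ t, c.γ t ≤ 1 := fun t => by
    rw [hγ]; exact Real.rpow_le_one_of_one_le_of_nonpos (hbase t) (by linarith)
  have hα0 : ∀ t, 0 ≤ c.α' t := fun t => by
    rw [hα]; exact Real.rpow_nonneg (by linarith [hbase t]) _
  have hinv := fun (t : ℕ) (ht : 1 ≤ t) =>
    MAC.Config.law_invariant hr0 hr (fun t => (hγ0 t).le) hγ1 ht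
  have hbdd : ∀ t, 1 ≤ t → MAC.BddOn (c.law t) c.sqError := fun t ht =>
    ⟨_, fun x hx => MAC.Config.abs_sqError_le hr herg (hinv t ht x hx).1⟩
  refine ⟨fun t ht => (hbdd t (Finset.mem_Icc.1 ht).1).summable, ?_⟩
  set W : ℝ := τ * Real.log c.Tmax
  have hW0 : 0 ≤ W := mul_nonneg (Nat.cast_nonneg _) (Real.log_natCast_nonneg _)
  have hA0 : MAC.expect (c.law 1) c.sqError ≤ (|η₁| + rmax) ^ 2 := by
    refine (le_abs_self _).trans (MAC.abs_expect_le fun x hx => ?_)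
    simp only [MAC.Config.law, MAC.Config.init, PMF.mem_support_map_iff] at hx
    obtain ⟨s, -, rfl⟩ := hx
    exact MAC.Config.abs_sqError_le hr herg (by rw [hη])
  have hrec : ∀ k < T, MAC.expect (c.law (k + 1 + 1)) c.sqError
      ≤ (1 - c.γ (k + 1) / 2) * MAC.expect (c.law (k + 1)) c.sqError
        + 6 * ((2 * n + 1) * B * rmax) ^ 2 * (c.α' (k + 1) ^ 2 / c.γ (k + 1))
        + 186 * rmax ^ 2 * W * c.γ (k + 1) ^ 2
        + 24 * rmax ^ 2 * (W / c.Tmax) * c.γ (k + 1) := fun k hk => by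
    have hk1 : 1 ≤ k + 1 := by omega
    have hb := hbdd (k + 1 + 1) (by omega)
    rw [c.law_succ hk1] at hb ⊢
    have hbk := hbdd (k + 1) hk1
    have hle := MAC.expect_bind_le hb
      ((((hbk.const_mul (1 - c.γ (k + 1) / 2)).add
        (MAC.BddOn.const _ (6 * ((2 * n + 1) * B * rmax) ^ 2 *
          (c.α' (k + 1) ^ 2 / c.γ (k + 1))))).add
        (MAC.BddOn.const _ (186 * rmax ^ 2 * W * c.γ (k + 1) ^ 2))).add
        (MAC.BddOn.const _ (24 * rmax ^ 2 * (W / c.Tmax) * c.γ (k + 1)))) fun x hx => by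
        have := MAC.Config.expect_step_sqError_le hr0 hB0 hB hr herg hT (hγ0 (k + 1))
          (hγ1 (k + 1)) (hα0 (k + 1)) (hinv (k + 1) hk1 x hx).2
          (hτ (k + 1) (Finset.mem_Icc.2 ⟨hk1, hk⟩) x hx)
        rwa [hn] at this
    have hb1 := hbk.const_mul (1 - c.γ (k + 1) / 2)
    have hc := MAC.BddOn.const (c.law (k + 1))
    rwa [MAC.expect_add ((hb1.add (hc _)).add (hc _)) (hc _),
      MAC.expect_add (hb1.add (hc _)) (hc _), MAC.expect_add hb1 (hc _), MAC.expect_const,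
      MAC.expect_const, MAC.expect_const, MAC.expect_const_mul] at hle
  have hfin := hmain (fun k => MAC.expect (c.law (k + 1)) c.sqError) (fun k => c.γ (k + 1))
    (fun k => c.α' (k + 1)) (6 * ((2 * n + 1) * B * rmax) ^ 2) (186 * rmax ^ 2 * W)
    (24 * rmax ^ 2 * (W / c.Tmax)) T hT1
    (fun k => MAC.expect_nonneg fun x _ => sq_nonneg _) (by positivity) (by positivity)
    (by positivity) (fun k => hγ (k + 1)) (fun k => hα (k + 1)) hrec
  have hIcc : ∑ t ∈ Finset.Icc 1 T, MAC.expect (c.law t) c.sqError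
      = ∑ k ∈ Finset.range T, MAC.expect (c.law (k + 1)) c.sqError := by
    rw [Finset.sum_bij' (fun t _ => t - 1) (fun k _ => k + 1)]
    all_goals simp only [Finset.mem_Icc, Finset.mem_range]
    · omega
    · omega
    · omega
    · omega
    · intro t ht
      rw [Nat.sub_add_cancel ht.1]
  rw [hIcc]
  refine hfin.trans ?_
  rw [mul_assoc C]
  refine mul_le_mul_of_nonneg_left ?_ hC
  have ha : 0 ≤ (T : ℝ) ^ (ν - 1) := by positivity
  have hb : 0 ≤ (T : ℝ) ^ (-2 * (σ - ν)) := by positivity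
  have hd : 0 ≤ (T : ℝ) ^ (-ν) := by positivity
  set a := (T : ℝ) ^ (ν - 1)
  set b := (T : ℝ) ^ (-2 * (σ - ν))
  set d := (T : ℝ) ^ (-ν)
  set c₁ := 6 * ((2 * n + 1) * B * rmax) ^ 2
  have hc₁ : 0 ≤ c₁ := by positivity
  set E := (|η₁| + rmax) ^ 2
  have hE : 0 ≤ E := sq_nonneg _
  set R := rmax ^ 2
  have hR : 0 ≤ R := sq_nonneg _
  have hWT : 0 ≤ W / c.Tmax := by positivity
  calc _ ≤ (E + c₁) * a + c₁ * b + 186 * R * W * d + 24 * R * (W / c.Tmax) := by gcongr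
    _ ≤ (E + c₁ + 210 * R) * a + (E + c₁ + 210 * R) * b + (E + c₁ + 210 * R) * (W * d)
        + (E + c₁ + 210 * R) * (W / c.Tmax) := by
        rw [mul_assoc (186 * R)]
        exact add_le_add (add_le_add (add_le_add
          (mul_le_mul_of_nonneg_right (by linarith) ha)
          (mul_le_mul_of_nonneg_right (by linarith) hb))
          (mul_le_mul_of_nonneg_right (by linarith) (mul_nonneg hW0 hd)))
          (mul_le_mul_of_nonneg_right (by linarith) hWT)
    _ = _ := by ring
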